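/- Let $\varepsilon,\delta>0$, let $D_\varepsilon\subset\mathbb C=\mathbb R^2$ be the open disc of radius $\varepsilon$ about $0$, and let $S\colon D_\varepsilon\to\mathbb R$ be smooth with partial derivatives $S_1=\partial_1S$, $S_2=\partial_2S$. Assume that $\varepsilon$ is so small that $e^{2\delta}|b|\le e^{S_1(b)}$ for all $b\in D_\varepsilon$. On $\mathbb C^2$, with coordinates $(p,q)$, $p=p_1+ip_2$, $q=q_1+iq_2$, and symplectic form $\omega_0=dp_1\wedge dq_1+dp_2\wedge dq_2$, consider $H=H_1+iH_2\colon(p,q)\mapsto-\bar pq$, with Hamiltonian flows $\phi_{H_1}^t(p,q)=(e^tp,e^{-t}q)$ and $\phi_{H_2}^t(p,q)=(e^{it}p,e^{it}q)$ (the Hamiltonian vector field $V_f$ is given by $\omega_0(V_f,\cdot)=-df$). Put $\sigma_1(b)=(e^{S_1(b)+iS_2(b)},-e^{-S_1(b)+iS_2(b)}b)$ and $\sigma_2(b)=(-\bar b,1)$. The model focus-focus neighborhood $X_S$ is the quotient of $$X'=\{(p,q)\in\mathbb C^2:\ |pq|<\varepsilon,\ |q|\le1,\ |p|<e^{S_1(-\bar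 pq)+\delta}\}$$ by the equivalence relation generated by $(\phi_{H_1}^{t_1}\circ\phi_{H_2}^{t_2})(\sigma_1(b))\sim(\phi_{H_1}^{t_1}\circ\phi_{H_2}^{t_2})(\sigma_2(b))$ for $|b|<\varepsilon$ and $(t_1,t_2)\in[0,\delta)\times[0,2\pi)$. It is a smooth manifold, with the two charts given by the inverses of the quotient map on $\{|pq|<\varepsilon,\ |q|<1,\ |p|<e^{S_1(-\bar pq)}\}$ and on $\{|pq|<\varepsilon,\ e^{S_1(-\bar pq)-\delta}<|p|<e^{S_1(-\bar pq)+\delta}\}$; the form $\omega_0$ and the map $H$ descend to $X_S$, giving a symplectic form and a map $H=H_1+iH_2\colon X_S\to D_\varepsilon$, and $\sigma_1,\sigma_2$ descend to one section $\sigma_S\colon D_\varepsilon\to X_S$. Let $s\in X_S$ be the class of the origin and $F_s=H^{-1}(0)$. Write $\phi_H^{t}=\phi_{H_1}^{t_1}\circ\phi_{H_2}^{t_2}$, $t=(t_1,t_2)\in\mathbb R^2$, for the joint Hamiltonian flow on $X_S$. For $x,y$ in the same fiber $H^{-1}(b)$, $b\ne0$, put $x+y=\phi_H^{t+t'}(\sigma_S(b))$,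 where $\phi_H^{t}(\sigma_S(b))=x$ and $\phi_H^{t'}(\sigma_S(b))=y$. Then this addition is well defined on the regular fibers, and it extends to a smooth map $$F\colon\bigl(X_S\times_{D_\varepsilon}X_S\bigr)\setminus\{(s,s)\}\to X_S$$ over the projection to $D_\varepsilon$; that is, $H(F(x,y))=H(x)=H(y)$ for all $(x,y)$ in the domain, and $F(x,y)=x+y$ if $H(x)=H(y)\neq0$. Moreover: 1. On the regular part $F_s\setminus\{s\}$ of the singular fiber, $F$ is a group operation, and the group is isomorphic to $(\mathbb C^*,\times)$: the map $\theta$ that sends $z\in\mathbb C^*$ to the class of $(ze^{S_1(0)+iS_2(0)},0)$ if $|z|\le1$, and to the class of $(0,1/\bar z)$ if $|z|>1$, is a bijection $\mathbb C^*\to F_s\setminus\{s\}$ with $F(\theta(z),\theta(w))=\theta(zw)$ for all $z,w\in\mathbb C^*$. 2. $F(s,x)=F(x,s)=s$ for every $x\in F_s\setminus\{s\}$. -/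

import Mathlib

open Set Metric Topology ComplexConjugate
open scoped Manifold ContDiff

noncomputable section

namespace FocusFocus

/-- The standard phase space `ℂ² = ℝ⁴`, with points written `(p, q)`. -/
abbrev E : Type := ℂ × ℂ

/-- The standard focus-focus map `(p, q) ↦ -p̄ q = H₁ + i H₂`. -/
def stdH (x : E) : ℂ := -(conj x.1 * x.2)

/-- The standard symplectic form `dp₁ ∧ dq₁ + dp₂ ∧ dq₂`, where `p = p₁ + i p₂`, `q = q₁ + i q₂`. -/
def stdOmega (v w : E) : ℝ :=
  (v.1.re * w.2.re - w.1.re * v.2.re) + (v.1.im * w.2.im - w.1.im * v.2.im)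

/-- The joint Hamiltonian flow `φ_{H₁}^{t₁} ∘ φ_{H₂}^{t₂}` of the standard system:
`(p, q) ↦ (e^{t₁ + i t₂} p, e^{-t₁ + i t₂} q)`. -/
def stdFlow (t₁ t₂ : ℝ) (x : E) : E :=
  (Complex.exp (t₁ + t₂ * Complex.I) * x.1, Complex.exp (-t₁ + t₂ * Complex.I) * x.2)

/-- The data of a model focus-focus neighborhood: a smooth real function `S` on the open disc
`D_ε`, and the width `δ` of the collar along which the ends of the standard system are glued.
The smallness condition `e^{2δ} |b| ≤ e^{S₁(b)}`, i.e. `2δ ≤ S₁(b) - ln |b|`, says that the time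
`S₁(b) - ln |b|` needed to flow from `σ₂(b)` to `σ₁(b)` is at least `2δ`, so that the two collars
are disjoint; for given `S` and `δ` it holds after shrinking `ε`. -/
structure Model where
  ε : ℝ
  δ : ℝ
  S : ℂ → ℝ
  ε_pos : 0 < ε
  δ_pos : 0 < δ
  smooth : ContDiffOn ℝ ∞ S (ball 0 ε)
  small : ∀ b ∈ ball (0 : ℂ) ε, Real.exp (2 * δ) * ‖b‖ ≤ Real.exp (fderiv ℝ S b 1)

namespace Model

variable (M : Model)

/-- The partial derivative `S₁ = ∂₁ S`. -/
def S₁ (b : ℂ) : ℝ := fderiv ℝ M.S b 1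

/-- The partial derivative `S₂ = ∂₂ S`. -/
def S₂ (b : ℂ) : ℝ := fderiv ℝ M.S b Complex.I

/-- The section `σ₁(b) = (φ_{H₁}^{S₁(b)} ∘ φ_{H₂}^{S₂(b)}) (1, -b)` of the standard system. -/
def σ₁ (b : ℂ) : E := stdFlow (M.S₁ b) (M.S₂ b) (1, -b)

/-- The section `σ₂(b) = (-b̄, 1)` of the standard system. -/
def σ₂ (b : ℂ) : E := (-conj b, 1)

/-- The part `X'` of the standard system that is glued to give `X_S`. -/
def preX : Set E :=
  {x | ‖x.1 * x.2‖ < M.ε ∧ ‖x.2‖ ≤ 1 ∧ ‖x.1‖ < Real.exp (M.S₁ (stdH x) + M.δ)}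

/-- The gluing relation: for `|b| < ε` and `(t₁, t₂) ∈ [0, δ) × [0, 2π)`, the point reached from
`σ₂(b)` in time `(t₁, t₂)` is identified with the point reached from `σ₁(b)` in this time. -/
def Glue (x y : E) : Prop :=
  ∃ b ∈ ball (0 : ℂ) M.ε, ∃ t₁ ∈ Ico 0 M.δ, ∃ t₂ ∈ Ico 0 (2 * Real.pi),
    x = stdFlow t₁ t₂ (σ₂ b) ∧ y = stdFlow t₁ t₂ (M.σ₁ b)

/-- The model neighborhood `X_S`: the quotient of `X'` by the equivalence relation generated by
the gluing relation. -/
def X : Type := Quot fun x y : M.preX => M.Glue x y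

/-- The quotient topology. -/
instance : TopologicalSpace M.X := inferInstanceAs (TopologicalSpace (Quot _))

/-- The quotient map `X' → X_S`. -/
def proj (x : M.preX) : M.X := Quot.mk _ x

/-! ### The gluing map in coordinates -/

/-- The number `e^{S₁(b) + i S₂(b)}`. -/
def eS (b : ℂ) : ℂ := Complex.exp (M.S₁ b + M.S₂ b * Complex.I)

/-- The gluing map `(p, q) ↦ (e^{S₁ + i S₂} / q̄, p̄ q² e^{-S₁ + i S₂})`. -/
def glueMap (x : E) : E :=
  (M.eS (stdH x) / conj x.2, conj x.1 * x.2 ^ 2 / conj (M.eS (stdH x)))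

/-- The inverse gluing map `(p, q) ↦ (p² q̄ e^{-S₁ - i S₂}, e^{S₁ - i S₂} / p̄)`. -/
def glueInv (x : E) : E :=
  (x.1 ^ 2 * conj x.2 / M.eS (stdH x), conj (M.eS (stdH x)) / conj x.1)

lemma eS_ne (b : ℂ) : M.eS b ≠ 0 := Complex.exp_ne_zero _

lemma norm_eS (b : ℂ) : ‖M.eS b‖ = Real.exp (M.S₁ b) := by
  simp [eS, Complex.norm_exp]

lemma norm_stdH (x : E) : ‖stdH x‖ = ‖x.1 * x.2‖ := by simp [stdH]

lemma stdH_mem {x : E} (h : ‖x.1 * x.2‖ < M.ε) : stdH x ∈ ball (0 : ℂ) M.ε := by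
  simpa [norm_stdH] using h

lemma conj_exp (a b : ℝ) :
    conj (Complex.exp (a + b * Complex.I)) = (Complex.exp (-a + b * Complex.I))⁻¹ := by
  rw [← Complex.exp_conj, ← Complex.exp_neg]
  congr 1
  simp [Complex.conj_ofReal]
  ring

lemma stdH_stdFlow (t₁ t₂ : ℝ) (x : E) : stdH (stdFlow t₁ t₂ x) = stdH x := by
  have := Complex.exp_ne_zero (-(t₁ : ℂ) + t₂ * Complex.I)
  simp only [stdH, stdFlow, map_mul, conj_exp]
  field_simp

lemma stdH_σ₂ (b : ℂ) : stdH (σ₂ b) = b := by simp [stdH, σ₂]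

lemma stdH_σ₁ (b : ℂ) : stdH (M.σ₁ b) = b := by
  rw [σ₁, stdH_stdFlow]; simp [stdH]

lemma norm_exp' (a b : ℝ) : ‖Complex.exp (a + b * Complex.I)‖ = Real.exp a := by
  simp [Complex.norm_exp]

lemma norm_exp_neg' (a b : ℝ) : ‖Complex.exp (-a + b * Complex.I)‖ = Real.exp (-a) := by
  simp [Complex.norm_exp]

lemma conj_exp_neg (a b : ℝ) :
    conj (Complex.exp (-a + b * Complex.I)) = (Complex.exp (a + b * Complex.I))⁻¹ := by
  have := conj_exp (-a) b
  simpa using this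

lemma glueMap_flow (t₁ t₂ : ℝ) (b : ℂ) :
    M.glueMap (stdFlow t₁ t₂ (σ₂ b)) = stdFlow t₁ t₂ (M.σ₁ b) := by
  have h1 := Complex.exp_ne_zero (-(t₁ : ℂ) + t₂ * Complex.I)
  have h2 := Complex.exp_ne_zero ((t₁ : ℂ) + t₂ * Complex.I)
  have h3 := Complex.exp_ne_zero (-(M.S₁ b : ℂ) + M.S₂ b * Complex.I)
  have h4 := Complex.exp_ne_zero ((M.S₁ b : ℂ) + M.S₂ b * Complex.I)
  rw [glueMap, stdH_stdFlow, stdH_σ₂]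
  ext1
  · simp only [σ₁, stdFlow, σ₂, eS, map_mul, conj_exp_neg, map_one]
    field_simp
  · simp only [σ₁, stdFlow, σ₂, eS, map_mul, conj_exp, map_neg, Complex.conj_conj]
    field_simp

lemma glueInv_flow (t₁ t₂ : ℝ) (b : ℂ) :
    M.glueInv (stdFlow t₁ t₂ (M.σ₁ b)) = stdFlow t₁ t₂ (σ₂ b) := by
  have h1 := Complex.exp_ne_zero (-(t₁ : ℂ) + t₂ * Complex.I)
  have h2 := Complex.exp_ne_zero ((t₁ : ℂ) + t₂ * Complex.I)
  have h3 := Complex.exp_ne_zero (-(M.S₁ b : ℂ) + M.S₂ b * Complex.I)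
  have h4 := Complex.exp_ne_zero ((M.S₁ b : ℂ) + M.S₂ b * Complex.I)
  rw [glueInv, stdH_stdFlow, stdH_σ₁]
  ext1
  · simp only [σ₁, stdFlow, σ₂, eS, map_mul, conj_exp_neg, map_neg, mul_one]
    field_simp
  · simp only [σ₁, stdFlow, σ₂, eS, map_mul, conj_exp, map_one]
    field_simp

/-- Polar coordinates: every nonzero complex number is `e^{a + i t}` with `t ∈ [0, 2π)`. -/
lemma exists_polar (z : ℂ) (hz : z ≠ 0) :
    ∃ t ∈ Ico 0 (2 * Real.pi), z = Complex.exp (Real.log ‖z‖ + (t : ℝ) * Complex.I) := by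
  refine ⟨toIcoMod Real.two_pi_pos 0 z.arg, by simpa using toIcoMod_mem_Ico Real.two_pi_pos 0 z.arg,
    ?_⟩
  have h : toIcoMod Real.two_pi_pos 0 z.arg
      = z.arg - toIcoDiv Real.two_pi_pos 0 z.arg * (2 * Real.pi) := by
    rw [← zsmul_eq_mul]; rfl
  rw [h]
  have : (Real.log ‖z‖ : ℂ) + ((z.arg - toIcoDiv Real.two_pi_pos 0 z.arg * (2 * Real.pi) : ℝ) : ℂ)
      * Complex.I = Complex.log z
        - (toIcoDiv Real.two_pi_pos 0 z.arg : ℤ) * (2 * Real.pi * Complex.I) := by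
    rw [Complex.log]; push_cast; ring
  rw [this, Complex.exp_periodic.sub_int_mul_eq, Complex.exp_log hz]

lemma glue_of_left {x : E} (hx : x ∈ M.preX) (h : Real.exp (-M.δ) < ‖x.2‖) :
    M.Glue x (M.glueMap x) := by
  have hq : x.2 ≠ 0 := by
    intro h0; rw [h0, norm_zero] at h; exact absurd h (Real.exp_pos _).not_gt
  have hqn : 0 < ‖x.2‖ := norm_pos_iff.2 hq
  obtain ⟨t, ht, hz⟩ := exists_polar x.2 hq
  have key : x = stdFlow (-Real.log ‖x.2‖) t (σ₂ (stdH x)) := by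
    ext1
    · simp only [stdFlow, σ₂, stdH, map_neg, map_mul, Complex.conj_conj, neg_neg]
      have : conj x.2 = (Complex.exp (((-Real.log ‖x.2‖ : ℝ) : ℂ) + t * Complex.I))⁻¹ := by
        rw [← conj_exp_neg]
        conv_lhs => rw [hz]
        simp
      rw [this]
      have := Complex.exp_ne_zero (((-Real.log ‖x.2‖ : ℝ) : ℂ) + t * Complex.I)
      field_simp
    · simp only [stdFlow, σ₂, mul_one]
      conv_lhs => rw [hz]
      simp
  refine ⟨stdH x, M.stdH_mem hx.1, -Real.log ‖x.2‖, ⟨?_, ?_⟩, t, ht, key, ?_⟩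
  · have := Real.log_nonpos hqn.le hx.2.1; linarith
  · have := Real.log_lt_log (Real.exp_pos _) h
    rw [Real.log_exp] at this; linarith
  · conv_lhs => rw [key]
    rw [glueMap_flow]

/-- Necessary conditions for two points to be glued. -/
lemma Glue.data {M : Model} {x y : E} (h : M.Glue x y) :
    ‖x.1 * x.2‖ < M.ε ∧ Real.exp (-M.δ) < ‖x.2‖ ∧ ‖x.2‖ ≤ 1 ∧
      Real.exp (M.S₁ (stdH y)) ≤ ‖y.1‖ ∧ (‖x.2‖ < 1 → Real.exp (M.S₁ (stdH y)) < ‖y.1‖) ∧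
      stdH y = stdH x ∧ y = M.glueMap x ∧ x = M.glueInv y := by
  obtain ⟨b, hb, t₁, ht₁, t₂, -, rfl, rfl⟩ := h
  have hn : ‖(stdFlow t₁ t₂ (M.σ₁ b)).1‖ = Real.exp t₁ * Real.exp (M.S₁ b) := by
    simp [stdFlow, σ₁, Complex.norm_exp]
  have hm : ‖(stdFlow t₁ t₂ (σ₂ b)).2‖ = Real.exp (-t₁) := by
    simp [stdFlow, σ₂, Complex.norm_exp]
  have hH : stdH (stdFlow t₁ t₂ (M.σ₁ b)) = b := by rw [stdH_stdFlow, stdH_σ₁]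
  have hH' : stdH (stdFlow t₁ t₂ (σ₂ b)) = b := by rw [stdH_stdFlow, stdH_σ₂]
  rw [hn, hm, hH, hH', ← norm_stdH, hH', M.glueMap_flow, M.glueInv_flow]
  refine ⟨by simpa using hb, Real.exp_lt_exp.2 (by linarith [ht₁.2]),
    Real.exp_le_one_iff.2 (by linarith [ht₁.1]), ?_, ?_, rfl, rfl, rfl⟩
  · exact le_mul_of_one_le_left (Real.exp_pos _).le (Real.one_le_exp ht₁.1)
  · intro h
    refine lt_mul_of_one_lt_left (Real.exp_pos _) (Real.one_lt_exp_iff.2 ?_)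
    have := Real.exp_lt_one_iff.1 h
    linarith

lemma small_exp {x : E} (h : ‖x.1 * x.2‖ < M.ε) :
    Real.exp (2 * M.δ) * (‖x.1‖ * ‖x.2‖) ≤ Real.exp (M.S₁ (stdH x)) := by
  have := M.small _ (M.stdH_mem h)
  rwa [norm_stdH, norm_mul] at this

/-- The left collar is disjoint from the region `|p| > e^{S₁ - δ}`. -/
lemma left_lt {x : E} (h : ‖x.1 * x.2‖ < M.ε) (h2 : Real.exp (-M.δ) < ‖x.2‖) :
    ‖x.1‖ ≤ Real.exp (M.S₁ (stdH x) - M.δ) := by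
  have h3 := M.small_exp h
  have h4 : Real.exp (2 * M.δ) * (‖x.1‖ * Real.exp (-M.δ)) ≤ Real.exp (M.S₁ (stdH x)) :=
    le_trans (by gcongr) h3
  have h5 : Real.exp (2 * M.δ) * (‖x.1‖ * Real.exp (-M.δ)) = ‖x.1‖ * Real.exp M.δ := by
    rw [mul_left_comm, ← Real.exp_add]; congr 2; ring
  rw [h5] at h4
  rw [Real.exp_sub, le_div_iff₀ (Real.exp_pos _)]
  exact h4

lemma not_left_right {x y z : E} (h : M.Glue x y) (h' : M.Glue y z) : False := by
  obtain ⟨-, -, -, h1, -⟩ := h.data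
  obtain ⟨h2, h3, -⟩ := h'.data
  have := M.left_lt h2 h3
  have h5 : Real.exp (M.S₁ (stdH y) - M.δ) < Real.exp (M.S₁ (stdH y)) :=
    Real.exp_lt_exp.2 (by linarith [M.δ_pos])
  linarith

lemma proj_eq_iff (x y : M.preX) :
    M.proj x = M.proj y ↔ x = y ∨ M.Glue x y ∨ M.Glue y x := by
  constructor
  · intro h
    replace h := Quot.eqvGen_exact h
    induction h with
    | rel _ _ h => exact Or.inr (Or.inl h)
    | refl => exact Or.inl rfl
    | symm _ _ _ ih => grind
    | trans a b c _ _ ih1 ih2 =>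
      rcases ih1 with rfl | h1 | h1
      · exact ih2
      · rcases ih2 with rfl | h2 | h2
        · exact Or.inr (Or.inl h1)
        · exact (M.not_left_right h1 h2).elim
        · left
          apply Subtype.ext
          rw [h1.data.2.2.2.2.2.2.2, h2.data.2.2.2.2.2.2.2]
      · rcases ih2 with rfl | h2 | h2
        · exact Or.inr (Or.inr h1)
        · left
          apply Subtype.ext
          rw [h1.data.2.2.2.2.2.2.1, h2.data.2.2.2.2.2.2.1]
        · exact (M.not_left_right h2 h1).elim
  · rintro (rfl | h | h)
    · rfl
    · exact Quot.sound (r := fun x y : M.preX => M.Glue x y) h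
    · exact (Quot.sound (r := fun x y : M.preX => M.Glue x y) h).symm

/-! ### The two charts -/

/-- The domain `𝔇⁰ = {|q| < 1, |p| < e^{S₁}}` of the first chart. -/
def dom₀ : Set E := {x | ‖x.1 * x.2‖ < M.ε ∧ ‖x.2‖ < 1 ∧ ‖x.1‖ < Real.exp (M.S₁ (stdH x))}

/-- The domain `𝔘 = {e^{S₁ - δ} < |p| < e^{S₁ + δ}}` of the second chart. -/
def dom₁ : Set E := {x | ‖x.1 * x.2‖ < M.ε ∧ Real.exp (M.S₁ (stdH x) - M.δ) < ‖x.1‖ ∧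
  ‖x.1‖ < Real.exp (M.S₁ (stdH x) + M.δ)}

lemma dom₀_subset : M.dom₀ ⊆ M.preX := fun x hx =>
  ⟨hx.1, hx.2.1.le, hx.2.2.trans (Real.exp_lt_exp.2 (by linarith [M.δ_pos]))⟩

lemma snd_lt_of_dom₁ {x : E} (hx : x ∈ M.dom₁) : ‖x.2‖ ≤ Real.exp (-M.δ) := by
  by_contra! h
  exact absurd (M.left_lt hx.1 h) hx.2.1.not_ge

lemma dom₁_subset : M.dom₁ ⊆ M.preX := fun x hx =>
  ⟨hx.1, (M.snd_lt_of_dom₁ hx).trans (Real.exp_le_one_iff.2 (by linarith [M.δ_pos])), hx.2.2⟩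

/-- The open subset `X = {|p q| < ε}` of the standard system. -/
def tube : Set E := {x | ‖x.1 * x.2‖ < M.ε}

lemma isOpen_tube : IsOpen M.tube := isOpen_lt (by fun_prop) continuous_const

lemma contDiff_stdH : ContDiff ℝ ∞ stdH := by
  have hc : ContDiff ℝ ∞ (fun z : ℂ => conj z) := Complex.conjCLE.contDiff
  exact ((hc.comp contDiff_fst).mul contDiff_snd).neg

lemma contDiffOn_fderiv (v : ℂ) :
    ContDiffOn ℝ ∞ (fun b => fderiv ℝ M.S b v) (ball 0 M.ε) :=
  (M.smooth.fderiv_of_isOpen isOpen_ball (m := ∞) (by simp)).clm_apply contDiffOn_const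

lemma contDiffOn_S₁ : ContDiffOn ℝ ∞ (fun x => M.S₁ (stdH x)) M.tube :=
  (M.contDiffOn_fderiv 1).comp contDiff_stdH.contDiffOn fun _ hx => M.stdH_mem hx

lemma contDiffOn_S₂ : ContDiffOn ℝ ∞ (fun x => M.S₂ (stdH x)) M.tube :=
  (M.contDiffOn_fderiv Complex.I).comp contDiff_stdH.contDiffOn fun _ hx => M.stdH_mem hx

lemma contDiffOn_eS : ContDiffOn ℝ ∞ (fun x => M.eS (stdH x)) M.tube := by
  have hc : ContDiff ℝ ∞ (fun z : ℝ => (z : ℂ)) := Complex.ofRealCLM.contDiff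
  exact ((hc.comp_contDiffOn M.contDiffOn_S₁).add
    ((hc.comp_contDiffOn M.contDiffOn_S₂).mul contDiffOn_const)).cexp

lemma contDiff_conj : ContDiff ℝ ∞ (fun z : ℂ => conj z) := Complex.conjCLE.contDiff

lemma contDiffOn_glueMap : ContDiffOn ℝ ∞ M.glueMap (M.tube ∩ {x | x.2 ≠ 0}) := by
  have h := M.contDiffOn_eS.mono (inter_subset_left (t := {x : E | x.2 ≠ 0}))
  have h1 : ContDiffOn ℝ ∞ (fun x : E => conj x.2) (M.tube ∩ {x | x.2 ≠ 0}) :=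
    (contDiff_conj.comp contDiff_snd).contDiffOn
  have h2 : ContDiffOn ℝ ∞ (fun x : E => conj (M.eS (stdH x))) (M.tube ∩ {x | x.2 ≠ 0}) :=
    contDiff_conj.comp_contDiffOn h
  have h3 : ContDiff ℝ ∞ (fun x : E => conj x.1 * x.2 ^ 2) :=
    (contDiff_conj.comp contDiff_fst).mul (contDiff_snd.pow 2)
  have h4 := h.mul (h1.inv fun x hx => by simpa using hx.2)
  have h5 := h3.contDiffOn.mul (h2.inv fun x _ => by simpa using M.eS_ne _)
  refine (h4.prodMk h5).congr fun x _ => ?_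
  simp only [glueMap, div_eq_mul_inv, Pi.inv_apply]

lemma contDiffOn_glueInv : ContDiffOn ℝ ∞ M.glueInv (M.tube ∩ {x | x.1 ≠ 0}) := by
  have h := M.contDiffOn_eS.mono (inter_subset_left (t := {x : E | x.1 ≠ 0}))
  have h1 : ContDiffOn ℝ ∞ (fun x : E => conj x.1) (M.tube ∩ {x | x.1 ≠ 0}) :=
    (contDiff_conj.comp contDiff_fst).contDiffOn
  have h2 : ContDiffOn ℝ ∞ (fun x : E => conj (M.eS (stdH x))) (M.tube ∩ {x | x.1 ≠ 0}) :=
    contDiff_conj.comp_contDiffOn h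
  have h3 : ContDiff ℝ ∞ (fun x : E => x.1 ^ 2 * conj x.2) :=
    (contDiff_fst.pow 2).mul (contDiff_conj.comp contDiff_snd)
  have h4 := h3.contDiffOn.mul (h.inv fun x _ => M.eS_ne _)
  have h5 := h2.mul (h1.inv fun x hx => by simpa using hx.2)
  refine (h4.prodMk h5).congr fun x _ => ?_
  simp only [glueInv, div_eq_mul_inv, Pi.inv_apply]

lemma isOpen_tube_snd : IsOpen (M.tube ∩ {x | x.2 ≠ 0}) :=
  M.isOpen_tube.inter (isOpen_ne_fun continuous_snd continuous_const)

lemma isOpen_tube_fst : IsOpen (M.tube ∩ {x | x.1 ≠ 0}) :=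
  M.isOpen_tube.inter (isOpen_ne_fun continuous_fst continuous_const)

/-- The part of the tube to the right of the section `σ₁`. -/
def right : Set E := M.tube ∩ {x | Real.exp (M.S₁ (stdH x)) < ‖x.1‖}

lemma isOpen_right : IsOpen M.right := by
  have h : ContinuousOn (fun x : E => ‖x.1‖ - Real.exp (M.S₁ (stdH x))) M.tube :=
    continuous_fst.norm.continuousOn.sub M.contDiffOn_S₁.continuousOn.rexp
  have := h.isOpen_inter_preimage M.isOpen_tube (isOpen_Ioi (a := (0 : ℝ)))
  convert this using 1
  ext x; simp [right]

lemma isOpen_dom₀ : IsOpen M.dom₀ := by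
  have h : ContinuousOn (fun x : E => Real.exp (M.S₁ (stdH x)) - ‖x.1‖) M.tube :=
    M.contDiffOn_S₁.continuousOn.rexp.sub continuous_fst.norm.continuousOn
  have h1 := h.isOpen_inter_preimage M.isOpen_tube (isOpen_Ioi (a := (0 : ℝ)))
  have h2 : IsOpen {x : E | ‖x.2‖ < 1} := isOpen_lt (by fun_prop) continuous_const
  convert h1.inter h2 using 1
  ext x; simp [dom₀, tube]; tauto

lemma isOpen_dom₁ : IsOpen M.dom₁ := by
  have h : ContinuousOn (fun x : E => Real.exp (M.S₁ (stdH x) + M.δ) - ‖x.1‖) M.tube :=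
    (M.contDiffOn_S₁.continuousOn.add continuousOn_const).rexp.sub
      continuous_fst.norm.continuousOn
  have h' : ContinuousOn (fun x : E => ‖x.1‖ - Real.exp (M.S₁ (stdH x) - M.δ)) M.tube :=
    continuous_fst.norm.continuousOn.sub
      (M.contDiffOn_S₁.continuousOn.sub continuousOn_const).rexp
  have h1 := h.isOpen_inter_preimage M.isOpen_tube (isOpen_Ioi (a := (0 : ℝ)))
  have h2 := h'.isOpen_inter_preimage M.isOpen_tube (isOpen_Ioi (a := (0 : ℝ)))
  convert h1.inter h2 using 1
  ext x; simp [dom₁, tube]; tauto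

/-- The map `𝔇⁰ → X_S`. -/
def φ₀ (x : M.dom₀) : M.X := M.proj ⟨x, M.dom₀_subset x.2⟩

/-- The map `𝔘 → X_S`. -/
def φ₁ (x : M.dom₁) : M.X := M.proj ⟨x, M.dom₁_subset x.2⟩

lemma not_glue_dom₀ {x y : E} (h : M.Glue x y) (hy : y ∈ M.dom₀) : False :=
  absurd h.data.2.2.2.1 hy.2.2.not_ge

lemma not_glue_dom₁ {x y : E} (h : M.Glue x y) (hx : x ∈ M.dom₁) : False :=
  absurd h.data.2.1 (M.snd_lt_of_dom₁ hx).not_gt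

lemma continuous_proj : Continuous M.proj := continuous_quot_mk

lemma isOpen_iff_proj {s : Set M.X} : IsOpen s ↔ IsOpen (M.proj ⁻¹' s) := Iff.rfl

lemma isOpenEmbedding_φ₀ : IsOpenEmbedding M.φ₀ := by
  refine .of_continuous_injective_isOpenMap
    (M.continuous_proj.comp (by fun_prop)) ?_ ?_
  · intro x y h
    rcases (M.proj_eq_iff _ _).1 h with h | h | h
    · exact Subtype.ext (Subtype.mk.inj h)
    · exact (M.not_glue_dom₀ h y.2).elim
    · exact (M.not_glue_dom₀ h x.2).elim
  · intro W hW
    have hW' : IsOpen (Subtype.val '' W) := M.isOpen_dom₀.isOpenMap_subtype_val _ hW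
    have hcont : ContinuousOn M.glueInv M.right :=
      M.contDiffOn_glueInv.continuousOn.mono fun x hx => ⟨hx.1, by
        intro h0
        have h1 : Real.exp (M.S₁ (stdH x)) < ‖x.1‖ := hx.2
        rw [h0, norm_zero] at h1
        exact absurd h1 (Real.exp_pos _).not_gt⟩
    have hO := hW'.union (hcont.isOpen_inter_preimage M.isOpen_right hW')
    rw [isOpen_iff_proj]
    convert hO.preimage (continuous_subtype_val (p := fun x => x ∈ M.preX)) using 1
    ext x
    simp only [mem_preimage, mem_image, mem_union, mem_inter_iff]
    constructor
    · rintro ⟨w, hw, h⟩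
      rcases (M.proj_eq_iff _ _).1 h with h | h | h
      · exact Or.inl ⟨w, hw, by rw [← h]⟩
      · exact Or.inr ⟨⟨x.2.1, h.data.2.2.2.2.1 w.2.2.1⟩, w, hw, h.data.2.2.2.2.2.2.2⟩
      · exact (M.not_glue_dom₀ h w.2).elim
    · rintro (⟨w, hw, h⟩ | ⟨hx, w, hw, h⟩)
      · exact ⟨w, hw, congrArg M.proj (Subtype.ext h)⟩
      · refine ⟨w, hw, (M.proj_eq_iff _ _).2 (Or.inr (Or.inl ?_))⟩
        have hp : x.1.1 ≠ 0 := by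
          intro h0
          have h1 : Real.exp (M.S₁ (stdH x.1)) < ‖x.1.1‖ := hx.2
          rw [h0, norm_zero] at h1
          exact absurd h1 (Real.exp_pos _).not_gt
        have hpn : 0 < ‖x.1.1‖ := norm_pos_iff.2 hp
        have hH : stdH w.1 = stdH x.1 := by
          have := M.eS_ne (stdH x.1)
          rw [h]
          simp only [stdH, glueInv, map_div₀, map_mul, map_pow, Complex.conj_conj]
          have h3 : conj x.1.1 ≠ 0 := by simpa using hp
          have h4 : conj (M.eS (-(conj x.1.1 * x.1.2))) ≠ 0 := by simpa using M.eS_ne _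
          field_simp
        have hq : Real.exp (-M.δ) < ‖w.1.2‖ := by
          rw [h]
          simp only [glueInv, norm_div, RCLike.norm_conj, norm_eS]
          rw [lt_div_iff₀ hpn]
          calc Real.exp (-M.δ) * ‖x.1.1‖
              < Real.exp (-M.δ) * Real.exp (M.S₁ (stdH x.1) + M.δ) := by
                gcongr; exact x.2.2.2
            _ = _ := by rw [← Real.exp_add]; congr 1; ring
        have hg := M.glue_of_left (M.dom₀_subset w.2) hq
        have : M.glueMap w.1 = x.1 := by
          have h5 := M.eS_ne (stdH x.1)
          have h3 : conj x.1.1 ≠ 0 := by simpa using hp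
          have h4 : conj (M.eS (stdH x.1)) ≠ 0 := by simpa using h5
          rw [glueMap, hH, h]
          ext1
          · simp only [glueInv, map_div₀, Complex.conj_conj]
            field_simp
          · simp only [glueInv, map_div₀, map_mul, map_pow, Complex.conj_conj]
            field_simp
        rwa [this] at hg

lemma stdH_glueMap {x : E} (hq : x.2 ≠ 0) : stdH (M.glueMap x) = stdH x := by
  have h3 : conj x.2 ≠ 0 := by simpa using hq
  have h4 : conj (M.eS (stdH x)) ≠ 0 := by simpa using M.eS_ne _
  conv_rhs => rw [stdH]
  rw [stdH, glueMap]
  simp only [map_div₀, Complex.conj_conj]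
  field_simp

lemma isOpenEmbedding_φ₁ : IsOpenEmbedding M.φ₁ := by
  refine .of_continuous_injective_isOpenMap
    (M.continuous_proj.comp (by fun_prop)) ?_ ?_
  · intro x y h
    rcases (M.proj_eq_iff _ _).1 h with h | h | h
    · exact Subtype.ext (Subtype.mk.inj h)
    · exact (M.not_glue_dom₁ h x.2).elim
    · exact (M.not_glue_dom₁ h y.2).elim
  · intro W hW
    have hW' : IsOpen (Subtype.val '' W) := M.isOpen_dom₁.isOpenMap_subtype_val _ hW
    have hO := hW'.union ((M.contDiffOn_glueMap.continuousOn.isOpen_inter_preimage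
      M.isOpen_tube_snd hW').inter (isOpen_lt continuous_const
        (continuous_snd.norm) : IsOpen {x : E | Real.exp (-M.δ) < ‖x.2‖}))
    rw [isOpen_iff_proj]
    convert hO.preimage (continuous_subtype_val (p := fun x => x ∈ M.preX)) using 1
    ext x
    simp only [mem_preimage, mem_image, mem_union, mem_inter_iff]
    constructor
    · rintro ⟨w, hw, h⟩
      rcases (M.proj_eq_iff _ _).1 h with h | h | h
      · exact Or.inl ⟨w, hw, by rw [← h]⟩
      · exact (M.not_glue_dom₁ h w.2).elim
      · refine Or.inr ⟨⟨⟨x.2.1, fun h0 => ?_⟩, w, hw, h.data.2.2.2.2.2.2.1⟩, h.data.2.1⟩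
        have h1 := h.data.2.1
        rw [h0, norm_zero] at h1
        exact absurd h1 (Real.exp_pos _).not_gt
    · rintro (⟨w, hw, h⟩ | ⟨⟨hx, w, hw, h⟩, hq⟩)
      · exact ⟨w, hw, congrArg M.proj (Subtype.ext h)⟩
      · refine ⟨w, hw, (M.proj_eq_iff _ _).2 (Or.inr (Or.inr ?_))⟩
        have := M.glue_of_left x.2 hq
        rwa [← h] at this

instance : Nonempty M.dom₀ :=
  ⟨⟨0, by simpa using M.ε_pos, by simp, by simpa using Real.exp_pos _⟩⟩

instance : Nonempty M.dom₁ :=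
  ⟨⟨(Real.exp (M.S₁ 0), 0), by simpa using M.ε_pos, by
    have := M.δ_pos
    simp [stdH, this]⟩⟩

/-- The first chart of `X_S`, the inverse of `φ₀`. -/
def chart₀ : OpenPartialHomeomorph M.X E :=
  (M.isOpenEmbedding_φ₀.toOpenPartialHomeomorph M.φ₀).symm.trans
    (M.isOpen_dom₀.isOpenEmbedding_subtypeVal.toOpenPartialHomeomorph Subtype.val)

/-- The second chart of `X_S`, the inverse of `φ₁`. -/
def chart₁ : OpenPartialHomeomorph M.X E :=
  (M.isOpenEmbedding_φ₁.toOpenPartialHomeomorph M.φ₁).symm.trans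
    (M.isOpen_dom₁.isOpenEmbedding_subtypeVal.toOpenPartialHomeomorph Subtype.val)

lemma chart₀_source : M.chart₀.source = range M.φ₀ := by
  simp [chart₀]

lemma chart₁_source : M.chart₁.source = range M.φ₁ := by
  simp [chart₁]

lemma chart₀_φ₀ (x : M.dom₀) : M.chart₀ (M.φ₀ x) = x := by
  simp [chart₀, IsOpenEmbedding.toOpenPartialHomeomorph_left_inv]

lemma chart₁_φ₁ (x : M.dom₁) : M.chart₁ (M.φ₁ x) = x := by
  simp [chart₁, IsOpenEmbedding.toOpenPartialHomeomorph_left_inv]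

lemma chart₀_target : M.chart₀.target = M.dom₀ := by
  simp [chart₀]

lemma chart₁_target : M.chart₁.target = M.dom₁ := by
  simp [chart₁]

lemma chart₀_symm (x : M.dom₀) : M.chart₀.symm x = M.φ₀ x := by
  have h : M.φ₀ x ∈ M.chart₀.source := by rw [chart₀_source]; exact ⟨x, rfl⟩
  conv_lhs => rw [← M.chart₀_φ₀ x]
  exact M.chart₀.left_inv h

lemma chart₁_symm (x : M.dom₁) : M.chart₁.symm x = M.φ₁ x := by
  have h : M.φ₁ x ∈ M.chart₁.source := by rw [chart₁_source]; exact ⟨x, rfl⟩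
  conv_lhs => rw [← M.chart₁_φ₁ x]
  exact M.chart₁.left_inv h

/-- The two charts cover `X_S`. -/
lemma mem_range (x : M.X) : x ∈ range M.φ₀ ∨ x ∈ range M.φ₁ := by
  obtain ⟨x, rfl⟩ := Quot.exists_rep x
  have hδ := M.δ_pos
  rcases le_or_gt (Real.exp (M.S₁ (stdH x.1))) ‖x.1.1‖ with h | h
  · right
    exact ⟨⟨x, x.2.1, lt_of_lt_of_le (Real.exp_lt_exp.2 (by linarith)) h, x.2.2.2⟩, rfl⟩
  · rcases x.2.2.1.lt_or_eq with hq | hq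
    · left
      exact ⟨⟨x, x.2.1, hq, h⟩, rfl⟩
    · right
      have hg := M.glue_of_left x.2 (by rw [hq]; exact Real.exp_lt_one_iff.2 (by linarith))
      have hq0 : x.1.2 ≠ 0 := by intro h0; simp [h0] at hq
      have hn : ‖(M.glueMap x).1‖ = Real.exp (M.S₁ (stdH x.1)) := by
        simp [glueMap, norm_eS, hq]
      have hH := M.stdH_glueMap hq0
      refine ⟨⟨M.glueMap x, ?_, ?_, ?_⟩, ?_⟩
      · rw [← norm_stdH, hH, norm_stdH]; exact x.2.1
      · rw [hH, hn]; exact Real.exp_lt_exp.2 (by linarith)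
      · rw [hH, hn]; exact Real.exp_lt_exp.2 (by linarith)
      · exact (M.proj_eq_iff _ _).2 (Or.inr (Or.inr hg))

open Classical in
/-- The atlas of `X_S` given by the two charts `φ₀⁻¹`, `φ₁⁻¹`. -/
instance : ChartedSpace E M.X where
  atlas := {M.chart₀, M.chart₁}
  chartAt x := if x ∈ range M.φ₀ then M.chart₀ else M.chart₁
  mem_chart_source x := by
    split_ifs with h
    · rwa [chart₀_source]
    · rw [chart₁_source]; exact (M.mem_range x).resolve_left h
  chart_mem_atlas x := by
    split_ifs <;> simp

/-- The transition maps are smooth, so that `X_S` is a smooth manifold. -/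
instance : IsManifold 𝓘(ℝ, E) ∞ M.X := by
  apply isManifold_of_contDiffOn
  intro e e' he he'
  simp only [modelWithCornersSelf_coe, modelWithCornersSelf_coe_symm, Function.id_comp,
    Function.comp_id, range_id, inter_univ, preimage_id]
  have hself : ∀ e : OpenPartialHomeomorph M.X E,
      ContDiffOn ℝ ∞ (e.symm ≫ₕ e) (e.symm ≫ₕ e).source := fun e => by
    refine contDiffOn_id.congr fun x hx => ?_
    simp only [OpenPartialHomeomorph.trans_source, mem_inter_iff] at hx
    exact e.right_inv hx.1
  rcases he with rfl | rfl <;> rcases he' with rfl | rfl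
  · exact hself _
  · intro x hx
    apply ContDiffAt.contDiffWithinAt
    simp only [OpenPartialHomeomorph.trans_source, OpenPartialHomeomorph.symm_source,
      mem_inter_iff, mem_preimage, chart₀_target, chart₁_source] at hx
    obtain ⟨hx0, y, hy⟩ := hx
    rw [M.chart₀_symm ⟨x, hx0⟩] at hy
    rcases (M.proj_eq_iff _ _).1 hy with h | h | h
    · have h : y.1 = x := congrArg Subtype.val h
      have hx1 : x ∈ M.dom₁ := h ▸ y.2
      refine contDiffAt_id.congr_of_eventuallyEq ?_
      filter_upwards [M.isOpen_dom₀.mem_nhds hx0, M.isOpen_dom₁.mem_nhds hx1] with z h0 h1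
      change M.chart₁ (M.chart₀.symm z) = z
      rw [M.chart₀_symm ⟨z, h0⟩]
      exact M.chart₁_φ₁ ⟨z, h1⟩
    · exact (M.not_glue_dom₁ h y.2).elim
    · have hyx : y.1 = M.glueMap x := h.data.2.2.2.2.2.2.1
      have hxq := h.data.2.1
      have hx2 : x ∈ M.tube ∩ {x | x.2 ≠ 0} := ⟨hx0.1, fun h0 => by
        simp only [h0, norm_zero] at hxq
        exact absurd hxq (Real.exp_pos _).not_gt⟩
      have hat := M.contDiffOn_glueMap.contDiffAt (M.isOpen_tube_snd.mem_nhds hx2)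
      refine hat.congr_of_eventuallyEq ?_
      have hin : M.glueMap x ∈ M.dom₁ := hyx ▸ y.2
      filter_upwards [M.isOpen_dom₀.mem_nhds hx0,
        hat.continuousAt.preimage_mem_nhds (M.isOpen_dom₁.mem_nhds hin),
        (isOpen_lt continuous_const continuous_snd.norm).mem_nhds hxq] with z h0 h1 h2
      change M.chart₁ (M.chart₀.symm z) = _
      rw [M.chart₀_symm ⟨z, h0⟩]
      have : M.φ₀ ⟨z, h0⟩ = M.φ₁ ⟨M.glueMap z, h1⟩ :=
        (M.proj_eq_iff _ _).2 (Or.inr (Or.inl (M.glue_of_left (M.dom₀_subset h0) h2)))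
      rw [this]
      exact M.chart₁_φ₁ ⟨_, h1⟩
  · intro x hx
    apply ContDiffAt.contDiffWithinAt
    simp only [OpenPartialHomeomorph.trans_source, OpenPartialHomeomorph.symm_source,
      mem_inter_iff, mem_preimage, chart₁_target, chart₀_source] at hx
    obtain ⟨hx1, y, hy⟩ := hx
    rw [M.chart₁_symm ⟨x, hx1⟩] at hy
    rcases (M.proj_eq_iff _ _).1 hy with h | h | h
    · have h : y.1 = x := congrArg Subtype.val h
      have hx0 : x ∈ M.dom₀ := h ▸ y.2
      refine contDiffAt_id.congr_of_eventuallyEq ?_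
      filter_upwards [M.isOpen_dom₀.mem_nhds hx0, M.isOpen_dom₁.mem_nhds hx1] with z h0 h1
      change M.chart₀ (M.chart₁.symm z) = z
      rw [M.chart₁_symm ⟨z, h1⟩]
      exact M.chart₀_φ₀ ⟨z, h0⟩
    · have hyx : y.1 = M.glueInv x := h.data.2.2.2.2.2.2.2
      have hxr : Real.exp (M.S₁ (stdH x)) < ‖x.1‖ := h.data.2.2.2.2.1 y.2.2.1
      have hx2 : x ∈ M.tube ∩ {x | x.1 ≠ 0} := ⟨hx1.1, fun h0 => by
        rw [h0, norm_zero] at hxr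
        exact absurd hxr (Real.exp_pos _).not_gt⟩
      have hat := M.contDiffOn_glueInv.contDiffAt (M.isOpen_tube_fst.mem_nhds hx2)
      refine hat.congr_of_eventuallyEq ?_
      have hx' : M.glueInv x ∈ Subtype.val '' (univ : Set M.dom₀) := ⟨y, trivial, hyx⟩
      have hO : M.φ₀ y ∈ range M.φ₀ := ⟨y, rfl⟩
      have hcont : ContinuousAt (M.chart₁.symm) x :=
        M.chart₁.continuousAt_symm (by rwa [chart₁_target])
      have hmem : M.chart₁.symm x ∈ range M.φ₀ := by
        rw [M.chart₁_symm ⟨x, hx1⟩]; exact ⟨y, hy⟩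
      filter_upwards [M.isOpen_dom₁.mem_nhds hx1,
        hcont.preimage_mem_nhds (M.isOpenEmbedding_φ₀.isOpen_range.mem_nhds hmem),
        M.isOpen_right.mem_nhds ⟨hx1.1, hxr⟩] with z h1 h2 h3
      change M.chart₀ (M.chart₁.symm z) = _
      obtain ⟨w, hw⟩ := h2
      rw [← hw, M.chart₀_φ₀]
      rw [M.chart₁_symm ⟨z, h1⟩] at hw
      rcases (M.proj_eq_iff _ _).1 hw with h | h | h
      · have h : w.1 = z := congrArg Subtype.val h
        have h4 : ‖z.1‖ < Real.exp (M.S₁ (stdH z)) := h ▸ w.2.2.2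
        exact absurd h3.2 h4.not_gt
      · exact h.data.2.2.2.2.2.2.2
      · exact (M.not_glue_dom₀ h w.2).elim
    · exact (M.not_glue_dom₀ h y.2).elim
  · exact hself _

/-! ### The integrable system on `X_S` and its fiberwise addition -/

/-- The map `H : X_S → D_ε ⊆ ℂ`, induced by `(p, q) ↦ -p̄ q`. -/
def H : M.X → ℂ :=
  Quot.lift (fun x => stdH x.1) fun _ _ h => (h.data.2.2.2.2.2.1).symm

lemma H_mem (x : M.X) : M.H x ∈ ball (0 : ℂ) M.ε := by
  obtain ⟨x, rfl⟩ := Quot.exists_rep x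
  exact M.stdH_mem x.2.1

/-- The symplectic form of `X_S`. The tangent space at `x` is identified with `ℂ²` by the preferred
chart at `x`, which is a local inverse of the quotient map; so this is the form induced by the
standard one. -/
def omega (x : M.X) (v w : TangentSpace 𝓘(ℝ, E) x) : ℝ := stdOmega v w

/-- The Hamiltonian vector field `V_f` of `f : X_S → ℝ`, given by Hamilton's equations
`ṗ = -∂f/∂q`, `q̇ = ∂f/∂p` in the preferred charts. Equivalently `ω(V_f, ·) = -df`, see below. -/
def hamVF (f : M.X → ℝ) (x : M.X) : TangentSpace 𝓘(ℝ, E) x :=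
  let df : E → ℝ := fun v => mfderiv 𝓘(ℝ, E) 𝓘(ℝ, ℝ) f x v
  ((⟨-df (0, 1), -df (0, Complex.I)⟩, ⟨df (1, 0), df (Complex.I, 0)⟩) : E)

lemma omega_hamVF (f : M.X → ℝ) (x : M.X) (w : TangentSpace 𝓘(ℝ, E) x) :
    M.omega x (M.hamVF f x) w = -(mfderiv 𝓘(ℝ, E) 𝓘(ℝ, ℝ) f x w : ℝ) := by
  have key : ∀ (L : E →L[ℝ] ℝ) (w : E),
      stdOmega (⟨-L (0, 1), -L (0, Complex.I)⟩, ⟨L (1, 0), L (Complex.I, 0)⟩) w = -L w := by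
    intro L w
    have hw : w = w.1.re • ((1, 0) : E) + w.1.im • ((Complex.I, 0) : E)
        + w.2.re • ((0, 1) : E) + w.2.im • ((0, Complex.I) : E) := by
      ext <;> simp
    conv_rhs => rw [hw]
    simp only [map_add, map_smul, stdOmega, smul_eq_mul]
    ring
  exact key _ w

/-- `y` is obtained from `x` by following the Hamiltonian flow of `f` for time `t`. -/
def FlowsTo (f : M.X → ℝ) (t : ℝ) (x y : M.X) : Prop :=
  ∃ γ : ℝ → M.X, IsMIntegralCurve (I := 𝓘(ℝ, E)) γ (M.hamVF f) ∧ γ 0 = x ∧ γ t = y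

/-- `y = φ_H^t (x)` for `t = (t₁, t₂)`, where `φ_H^t = φ_{H₁}^{t₁} ∘ φ_{H₂}^{t₂}` is the joint
Hamiltonian flow on `X_S` of the real part `H₁` and the imaginary part `H₂` of `H`. -/
def JointFlowsTo (t : ℝ × ℝ) (x y : M.X) : Prop :=
  ∃ z, M.FlowsTo (fun x => (M.H x).im) t.2 x z ∧ M.FlowsTo (fun x => (M.H x).re) t.1 z y

lemma σ₂_mem {b : ℂ} (hb : b ∈ ball (0 : ℂ) M.ε) : σ₂ b ∈ M.preX := by
  have hb' : ‖b‖ < M.ε := by simpa using hb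
  refine ⟨by simpa [σ₂] using hb', by simp [σ₂], ?_⟩
  rw [stdH_σ₂]
  have h1 := M.small b hb
  have h2 : ‖b‖ ≤ Real.exp (2 * M.δ) * ‖b‖ :=
    le_mul_of_one_le_left (norm_nonneg _) (Real.one_le_exp (by linarith [M.δ_pos]))
  have h3 : Real.exp (M.S₁ b) < Real.exp (M.S₁ b + M.δ) :=
    Real.exp_lt_exp.2 (by linarith [M.δ_pos])
  have h4 : ‖(σ₂ b).1‖ = ‖b‖ := by simp [σ₂]
  rw [h4]
  exact (h2.trans h1).trans_lt h3

/-- The section `σ_S : D_ε → X_S` to which both `σ₁` and `σ₂` descend. -/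
def secS (b : ball (0 : ℂ) M.ε) : M.X := M.proj ⟨σ₂ b, M.σ₂_mem b.2⟩

/-- The symplectic group structure as a relation: `z = (x + y)_σ`, i.e. `z = φ_H^{t + t'}(σ(b))` for
some `t`, `t'` with `φ_H^t (σ(b)) = x` and `φ_H^{t'} (σ(b)) = y`, where `σ = σ_S` and `b = H x`. -/
def IsSum (x y z : M.X) : Prop :=
  ∃ t t' : ℝ × ℝ,
    M.JointFlowsTo t (M.secS ⟨M.H x, M.H_mem x⟩) x ∧
    M.JointFlowsTo t' (M.secS ⟨M.H x, M.H_mem x⟩) y ∧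
    M.JointFlowsTo (t + t') (M.secS ⟨M.H x, M.H_mem x⟩) z

/-- The singular point `s`, the class of the origin. -/
def s : M.X := M.proj ⟨0, M.dom₀_subset ⟨by simpa using M.ε_pos, by simp,
  by simpa using Real.exp_pos _⟩⟩

/-- The fiber product `X_S ×_{D_ε} X_S` without the point `(s, s)`. Away from `s` the map `H` is a
submersion, so that this is an embedded submanifold of `X_S × X_S`. -/
def fiberProd : Set (M.X × M.X) := {a | M.H a.1 = M.H a.2} \ {(M.s, M.s)}

/-- The regular part of the singular fiber `F_s = H⁻¹(0)`. -/
def regFiber : Set M.X := {x | M.H x = 0} \ {M.s}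

/-- The parametrization `ℂ^* → F_s` which sends `z` to the class of `(z e^{S₁(0) + i S₂(0)}, 0)`
if `|z| ≤ 1`, and to the class of `(0, 1 / z̄)` if `|z| > 1`. -/
def param (z : ℂˣ) : M.X :=
  if h : ‖(z : ℂ)‖ ≤ 1 then
    M.proj ⟨(z * M.eS 0, 0), by simpa using M.ε_pos, by simp, by
      have h1 : Real.exp (M.S₁ 0) < Real.exp (M.S₁ 0 + M.δ) :=
        Real.exp_lt_exp.2 (by linarith [M.δ_pos])
      have h2 : ‖(z : ℂ)‖ * Real.exp (M.S₁ 0) ≤ Real.exp (M.S₁ 0) :=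
        mul_le_of_le_one_left (Real.exp_pos _).le h
      simpa [stdH, norm_eS] using h2.trans_lt h1⟩
  else
    M.proj ⟨(0, 1 / conj (z : ℂ)), by simpa using M.ε_pos, by
      simpa using inv_le_one_of_one_le₀ (not_le.1 h).le, by simpa using Real.exp_pos _⟩

/-- Smoothness, along a subset `P` of `X_S × X_S`, of a map to `X_S`: locally on `P` the map is the
restriction of a smooth map defined on an open subset of `X_S × X_S`. -/
def SmoothAlong (F : M.X × M.X → M.X) (P : Set (M.X × M.X)) : Prop :=
  ∀ a ∈ P, ∃ (W : Set (M.X × M.X)) (G : M.X × M.X → M.X), IsOpen W ∧ a ∈ W ∧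
    ContMDiffOn (𝓘(ℝ, E).prod 𝓘(ℝ, E)) 𝓘(ℝ, E) ∞ G W ∧ EqOn F G (W ∩ P)

end Model

end FocusFocus

end

noncomputable section

namespace FocusFocus

/-! The joint flow of the standard system is an action of `ℂ^*` on `ℂ²`, and everything reduces to
this action on `X_S`. The gluing map makes sense on all of `{|p q| < ε, q ≠ 0}`; it preserves `stdH`
and commutes with the action (`Step.act`). The smallness condition makes each application expand
`|p|` and contract `|q|` by a factor of at least `e^{2δ}`. Hence every orbit in the tube `{|p q| <
ε}` meets `X'` (`exists_preX`), and it does so in a single class (`glue_of_reflTransGen`). So `X_S`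
is also the quotient of the whole tube, through `toX`. The tube is invariant, so the action descends
to `X_S` as `smulX`; its one-parameter subgroups are the complete Hamiltonian flows
(`jointFlowsTo_iff`).

The section avoids `s`, and every `x ≠ s` is `w · σ_S(H x)` for some `w`. One can take `w = 1 / q̄`
where `q ≠ 0` and `w = p / e^{S₁ + i S₂}` where `p ≠ 0`, so `w` is smooth locally
(`exists_contMDiffOn_smulX_base`). If `x = v · σ` and `y = w · σ` lie in one fiber, their sum is `v
w · σ = w · x = v · y`. The formula `w · x` needs only `y ≠ s`, and `v · y` needs only `x ≠ s`;
together they define the extension off `(s, s)`. The choice of `v` and `w` does not matter: the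
group is commutative, so numbers moving `σ` to the same point agree on the whole fiber, and `s` is
fixed (`smulX_eq_smulX`).

On the singular fiber `θ(z) = z · σ_S(0)` (`param_eq`). The action is free and transitive on the
regular part, so addition there is multiplication in `ℂ^*`, while fixedness of `s` gives `s + x =
s`. -/

/-- The action `w · (p, q) = (w p, q / w̄)` of `ℂ^*` on `ℂ²`; for `w = e^{t₁ + i t₂}` this is the
joint flow of the standard system. -/
def act (w : ℂ) (x : E) : E := (w * x.1, x.2 / conj w)

lemma act_mul (v w : ℂ) (x : E) : act (v * w) x = act v (act w x) := by
  ext1 <;> simp only [act, map_mul]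
  · ring
  · rw [div_div, mul_comm]

@[simp] lemma act_one (x : E) : act 1 x = x := by simp [act]

@[simp] lemma act_zero_right (w : ℂ) : act w 0 = 0 := by simp [act]

lemma stdH_act {w : ℂ} (hw : w ≠ 0) (x : E) : stdH (act w x) = stdH x := by
  have : conj w ≠ 0 := by simpa using hw
  simp only [stdH, act, map_mul]
  field_simp

lemma contDiffAt_act {z : ℂ × E} (hz : z.1 ≠ 0) :
    ContDiffAt ℝ ∞ (fun z : ℂ × E => act z.1 z.2) z := by
  have h1 : ContDiff ℝ ∞ (fun z : ℂ × E => conj z.1) := Complex.conjCLE.contDiff.comp contDiff_fst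
  have h2 : ContDiff ℝ ∞ (fun z : ℂ × E => z.2.1) := contDiff_fst.comp contDiff_snd
  have h3 : ContDiff ℝ ∞ (fun z : ℂ × E => z.2.2) := contDiff_snd.comp contDiff_snd
  refine (contDiff_fst.mul h2).contDiffAt.prodMk ?_
  have := h3.contDiffAt (x := z) |>.mul (h1.contDiffAt (x := z) |>.inv (by simpa using hz))
  simp only [div_eq_mul_inv]
  exact this

namespace Model

variable (M : Model)

/-! ### Orbits of the unrestricted gluing map -/

lemma mem_tube_iff {x : E} : x ∈ M.tube ↔ stdH x ∈ ball (0 : ℂ) M.ε := by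
  simp [tube, norm_stdH]

/-- One application of the gluing map, without the restriction to the collar. -/
def Step (x y : E) : Prop := x ∈ M.tube ∧ x.2 ≠ 0 ∧ y = M.glueMap x

variable {M}

lemma stdH_glueInv {x : E} (hp : x.1 ≠ 0) : stdH (M.glueInv x) = stdH x := by
  have h3 : conj x.1 ≠ 0 := by simpa using hp
  have h4 : conj (M.eS (stdH x)) ≠ 0 := by simpa using M.eS_ne _
  conv_rhs => rw [stdH]
  rw [stdH, glueInv]
  simp only [map_div₀, map_mul, map_pow, Complex.conj_conj]
  field_simp

lemma glueInv_glueMap {x : E} (hq : x.2 ≠ 0) : M.glueInv (M.glueMap x) = x := by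
  have h3 : conj x.2 ≠ 0 := by simpa using hq
  have h4 := M.eS_ne (stdH x)
  have h5 : conj (M.eS (stdH x)) ≠ 0 := by simpa using h4
  rw [glueInv, M.stdH_glueMap hq, glueMap]
  ext1
  · simp only [map_div₀, map_mul, map_pow, Complex.conj_conj]
    field_simp
  · simp only [map_div₀, Complex.conj_conj]
    field_simp

lemma glueMap_glueInv {x : E} (hp : x.1 ≠ 0) : M.glueMap (M.glueInv x) = x := by
  have h3 : conj x.1 ≠ 0 := by simpa using hp
  have h4 := M.eS_ne (stdH x)
  have h5 : conj (M.eS (stdH x)) ≠ 0 := by simpa using h4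
  rw [glueMap, stdH_glueInv hp, glueInv]
  ext1
  · simp only [map_div₀, Complex.conj_conj]
    field_simp
  · simp only [map_div₀, map_mul, map_pow, Complex.conj_conj]
    field_simp

lemma Step.stdH_eq {x y : E} (h : M.Step x y) : stdH y = stdH x := by
  rw [h.2.2, M.stdH_glueMap h.2.1]

lemma Step.right_mem {x y : E} (h : M.Step x y) : y ∈ M.tube := by
  rw [mem_tube_iff, h.stdH_eq, ← mem_tube_iff]; exact h.1

lemma Step.fst_ne {x y : E} (h : M.Step x y) : y.1 ≠ 0 := by
  rw [h.2.2, glueMap]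
  exact div_ne_zero (M.eS_ne _) (by simpa using h.2.1)

lemma Step.eq_glueInv {x y : E} (h : M.Step x y) : x = M.glueInv y := by
  rw [h.2.2, glueInv_glueMap h.2.1]

lemma step_glueInv {x : E} (hx : x ∈ M.tube) (hp : x.1 ≠ 0) : M.Step (M.glueInv x) x := by
  refine ⟨?_, ?_, (glueMap_glueInv hp).symm⟩
  · rw [mem_tube_iff, stdH_glueInv hp, ← mem_tube_iff]; exact hx
  · exact div_ne_zero (by simpa using M.eS_ne _) (by simpa using hp)

/-- The twist `e^{S₁ + i S₂}` depends only on `stdH`, which the action preserves; this equivariance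
lets the action descend to `X_S`. -/
lemma Step.act {x y : E} (h : M.Step x y) {w : ℂ} (hw : w ≠ 0) :
    M.Step (act w x) (FocusFocus.act w y) := by
  have hw' : conj w ≠ 0 := by simpa using hw
  refine ⟨?_, div_ne_zero h.2.1 hw', ?_⟩
  · rw [mem_tube_iff, stdH_act hw, ← mem_tube_iff]; exact h.1
  · have h3 : conj x.2 ≠ 0 := by simpa using h.2.1
    have h5 : conj (M.eS (stdH x)) ≠ 0 := by simpa using M.eS_ne (stdH x)
    rw [h.2.2, glueMap, glueMap, stdH_act hw]
    ext1
    · simp only [FocusFocus.act, map_div₀, Complex.conj_conj]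
      field_simp
    · simp only [FocusFocus.act, map_mul]
      field_simp

lemma Step.norm_fst {x y : E} (h : M.Step x y) : ‖y.1‖ = Real.exp (M.S₁ (stdH x)) / ‖x.2‖ := by
  rw [h.2.2]; simp [glueMap, norm_eS]

/-- A step multiplies `|q|` by `|b| e^{-S₁(b)}` with `b = stdH x`, and the smallness condition
bounds this factor by `e^{-2δ}`. -/
lemma Step.norm_snd_le {x y : E} (h : M.Step x y) : Real.exp (2 * M.δ) * ‖y.2‖ ≤ ‖x.2‖ := by
  have h1 := M.small_exp h.1
  have h2 : ‖y.2‖ = ‖x.1‖ * ‖x.2‖ ^ 2 / Real.exp (M.S₁ (stdH x)) := by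
    rw [h.2.2]; simp [glueMap, norm_eS]
  rw [h2, mul_div_assoc', div_le_iff₀ (Real.exp_pos _)]
  calc _ = ‖x.2‖ * (Real.exp (2 * M.δ) * (‖x.1‖ * ‖x.2‖)) := by ring
    _ ≤ _ := by gcongr

lemma Step.norm_fst_le {x y : E} (h : M.Step x y) : Real.exp (2 * M.δ) * ‖x.1‖ ≤ ‖y.1‖ := by
  have h1 := M.small_exp h.1
  rw [h.norm_fst, le_div_iff₀ (norm_pos_iff.2 h.2.1), mul_assoc]
  exact h1

open Relation

/-- A step is a partial injection, hence deterministic forwards and backwards, so each equivalence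
class is a chain. -/
lemma Step.reflTransGen_or {x y : E} (h : EqvGen M.Step x y) :
    ReflTransGen M.Step x y ∨ ReflTransGen M.Step y x := by
  have hr : Relator.RightUnique M.Step := fun a b c hb hc => by rw [hb.2.2, hc.2.2]
  have hl : Relator.RightUnique (Function.swap M.Step) := fun a b c hb hc => by
    rw [Step.eq_glueInv hb, Step.eq_glueInv hc]
  induction h with
  | rel _ _ h => exact Or.inl (.single h)
  | refl => exact Or.inl .refl
  | symm _ _ _ ih => exact ih.symm
  | trans a b c _ _ ih1 ih2 =>
    rcases ih1 with h1 | h1 <;> rcases ih2 with h2 | h2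
    · exact Or.inl (h1.trans h2)
    · have := ReflTransGen.total_of_right_unique hl h1.swap h2.swap
      rcases this with h | h
      · exact Or.inr (reflTransGen_swap.1 h)
      · exact Or.inl (reflTransGen_swap.1 h)
    · exact ReflTransGen.total_of_right_unique hr h1 h2
    · exact Or.inr (h2.trans h1)

lemma eqvGen_stdH {x y : E} (h : EqvGen M.Step x y) : stdH x = stdH y := by
  induction h with
  | rel _ _ h => exact h.stdH_eq.symm
  | refl => rfl
  | symm _ _ _ ih => exact ih.symm
  | trans _ _ _ _ _ h1 h2 => exact h1.trans h2

lemma eqvGen_act {x y : E} (h : EqvGen M.Step x y) {w : ℂ} (hw : w ≠ 0) :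
    EqvGen M.Step (act w x) (act w y) := by
  induction h with
  | rel _ _ h => exact .rel _ _ (h.act hw)
  | refl => exact .refl _
  | symm _ _ _ ih => exact .symm _ _ ih
  | trans _ _ _ _ _ h1 h2 => exact .trans _ _ _ h1 h2

/-- Let `z → y` be the last step. The bound `|p| < e^{S₁ + δ}` at `y` forces `|q| > e^{-δ}` at `z`,
whereas `|q| ≤ e^{-2δ}` after at least one step from `X'`. So `z = x`, and the only step starts in
the collar. -/
lemma glue_of_reflTransGen {x y : E} (hx : x ∈ M.preX) (hy : y ∈ M.preX)
    (h : ReflTransGen M.Step x y) : x = y ∨ M.Glue x y := by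
  have key : ∀ z, ReflTransGen M.Step x z → z = x ∨ Real.exp (2 * M.δ) * ‖z.2‖ ≤ 1 := by
    intro z hz
    induction hz with
    | refl => exact Or.inl rfl
    | tail _ hs ih =>
      right
      refine hs.norm_snd_le.trans ?_
      rcases ih with rfl | ih
      · exact hx.2.1
      · refine le_trans (le_mul_of_one_le_left (norm_nonneg _) ?_) ih
        exact Real.one_le_exp (by linarith [M.δ_pos])
  rcases h.cases_tail with h | ⟨z, hz, hs⟩
  · exact Or.inl h.symm
  · have hz0 : 0 < ‖z.2‖ := norm_pos_iff.2 hs.2.1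
    have h1 := hy.2.2
    rw [hs.norm_fst, hs.stdH_eq, div_lt_iff₀ hz0, Real.exp_add, mul_assoc,
      lt_mul_iff_one_lt_right (Real.exp_pos _)] at h1
    rcases key z hz with rfl | h2
    · right
      rw [hs.2.2]
      refine M.glue_of_left hx ?_
      rw [Real.exp_neg, inv_lt_iff_one_lt_mul₀ (Real.exp_pos _), mul_comm]
      simpa [mul_comm] using h1
    · exfalso
      have h3 : Real.exp M.δ ≤ Real.exp (2 * M.δ) := Real.exp_le_exp.2 (by linarith [M.δ_pos])
      nlinarith

lemma proj_eq_of_eqvGen {x y : M.preX} (h : EqvGen M.Step x y) : M.proj x = M.proj y := by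
  rw [M.proj_eq_iff]
  rcases Step.reflTransGen_or h with h | h
  · rcases glue_of_reflTransGen x.2 y.2 h with h | h
    · exact Or.inl (Subtype.ext h)
    · exact Or.inr (Or.inl h)
  · rcases glue_of_reflTransGen y.2 x.2 h with h | h
    · exact Or.inl (Subtype.ext h.symm)
    · exact Or.inr (Or.inr h)

lemma Glue.step {x y : E} (h : M.Glue x y) : M.Step x y := by
  obtain ⟨h1, h2, -, -, -, -, h3, -⟩ := h.data
  exact ⟨h1, norm_pos_iff.1 ((Real.exp_pos _).trans h2), h3⟩

lemma eqvGen_of_proj_eq {x y : M.preX} (h : M.proj x = M.proj y) : EqvGen M.Step x y := by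
  rcases (M.proj_eq_iff _ _).1 h with rfl | h | h
  · exact .refl _
  · exact .rel _ _ h.step
  · exact .symm _ _ (.rel _ _ h.step)

/-- Backward steps shrink `|p|` geometrically until it is below `e^{S₁ + δ}`; `n` bounds their
number. -/
lemma exists_preX_aux₁ (n : ℕ) {x : E} (hx : x ∈ M.tube) (hq : ‖x.2‖ ≤ 1)
    (hp : ‖x.1‖ < Real.exp (M.S₁ (stdH x) + M.δ) * Real.exp (2 * M.δ) ^ n) :
    ∃ y ∈ M.preX, EqvGen M.Step x y := by
  induction n generalizing x with
  | zero => exact ⟨x, ⟨hx, hq, by simpa using hp⟩, .refl _⟩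
  | succ n ih =>
    rcases lt_or_ge ‖x.1‖ (Real.exp (M.S₁ (stdH x) + M.δ)) with h | h
    · exact ⟨x, ⟨hx, hq, h⟩, .refl _⟩
    · have hp0 : 0 < ‖x.1‖ := (Real.exp_pos _).trans_le h
      have hs := step_glueInv hx (norm_pos_iff.1 hp0)
      -- The preimage has `|q| = e^{S₁} / |p|`, and `|p| ≥ e^{S₁ + δ}` in this case.
      have h1 : ‖(M.glueInv x).2‖ ≤ 1 := by
        have h2 := hs.norm_fst
        rw [← hs.stdH_eq, eq_div_iff (norm_pos_iff.2 hs.2.1).ne', mul_comm] at h2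
        have h3 : Real.exp (M.S₁ (stdH x)) ≤ Real.exp (M.S₁ (stdH x) + M.δ) :=
          Real.exp_le_exp.2 (by linarith [M.δ_pos])
        rw [← mul_le_iff_le_one_left hp0, h2]
        exact h3.trans h
      obtain ⟨y, hy, hxy⟩ := ih hs.1 h1 (by
        have h2 := hs.norm_fst_le.trans_lt hp
        rw [← hs.stdH_eq]
        rw [pow_succ, ← mul_assoc, mul_comm] at h2
        exact lt_of_mul_lt_mul_right h2 (Real.exp_pos _).le)
      exact ⟨y, hy, .trans _ _ _ (.symm _ _ (.rel _ _ hs)) hxy⟩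

lemma one_lt_exp_two_δ : 1 < Real.exp (2 * M.δ) :=
  Real.one_lt_exp_iff.2 (by linarith [M.δ_pos])

/-- Forward steps shrink `|q|` to at most `1`, after which `exists_preX_aux₁` takes care of `|p|`.
-/
lemma exists_preX_aux₂ (n : ℕ) {x : E} (hx : x ∈ M.tube)
    (hq : ‖x.2‖ ≤ Real.exp (2 * M.δ) ^ n) : ∃ y ∈ M.preX, EqvGen M.Step x y := by
  induction n generalizing x with
  | zero =>
    obtain ⟨n, hn⟩ := pow_unbounded_of_one_lt
      (‖x.1‖ / Real.exp (M.S₁ (stdH x) + M.δ)) (one_lt_exp_two_δ (M := M))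
    rw [div_lt_iff₀' (Real.exp_pos _)] at hn
    exact exists_preX_aux₁ n hx (by simpa using hq) hn
  | succ n ih =>
    by_cases hq0 : x.2 = 0
    · exact ih hx (by rw [hq0, norm_zero]; positivity)
    · have hs : M.Step x (M.glueMap x) := ⟨hx, hq0, rfl⟩
      obtain ⟨y, hy, hxy⟩ := ih hs.right_mem (by
        have := hs.norm_snd_le.trans hq
        rw [pow_succ, mul_comm] at this
        exact le_of_mul_le_mul_right this (Real.exp_pos _))
      exact ⟨y, hy, .trans _ _ _ (.rel _ _ hs) hxy⟩

/-- Every orbit of the gluing map on the tube meets `X'`. -/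
lemma exists_preX {x : E} (hx : x ∈ M.tube) : ∃ y : M.preX, EqvGen M.Step x y := by
  obtain ⟨n, hn⟩ := pow_unbounded_of_one_lt ‖x.2‖ (one_lt_exp_two_δ (M := M))
  obtain ⟨y, hy, h⟩ := exists_preX_aux₂ n hx hn.le
  exact ⟨⟨y, hy⟩, h⟩

variable (M)

/-! ### Extension of the quotient map to the tube -/

open Classical in
/-- The extension of the quotient map `X' → X_S` to the tube `{|p q| < ε}`, constant on the orbits
of the gluing map. -/
def toX (x : E) : M.X := if hx : x ∈ M.tube then M.proj (exists_preX hx).choose else M.s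

variable {M}

lemma toX_eq_iff {x y : E} (hx : x ∈ M.tube) (hy : y ∈ M.tube) :
    M.toX x = M.toX y ↔ EqvGen M.Step x y := by
  rw [toX, toX, dif_pos hx, dif_pos hy]
  have h1 := (exists_preX hx).choose_spec
  have h2 := (exists_preX hy).choose_spec
  constructor
  · intro h
    exact .trans _ _ _ h1 (.trans _ _ _ (eqvGen_of_proj_eq h) (.symm _ _ h2))
  · intro h
    exact proj_eq_of_eqvGen (.trans _ _ _ (.symm _ _ h1) (.trans _ _ _ h h2))

lemma toX_eq_proj (x : M.preX) : M.toX x = M.proj x := by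
  have hx : x.1 ∈ M.tube := x.2.1
  rw [toX, dif_pos hx]
  exact proj_eq_of_eqvGen (.symm _ _ (exists_preX hx).choose_spec)

lemma toX_zero : M.toX 0 = M.s :=
  toX_eq_proj ⟨0, M.dom₀_subset ⟨by simpa using M.ε_pos, by simp,
    by simpa using Real.exp_pos _⟩⟩

lemma zero_mem_tube : (0 : E) ∈ M.tube := by simpa [tube] using M.ε_pos

lemma toX_surj (x : M.X) : ∃ y ∈ M.tube, M.toX y = x := by
  obtain ⟨y, rfl⟩ := Quot.exists_rep x
  exact ⟨y, y.2.1, toX_eq_proj y⟩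

lemma H_toX {x : E} (hx : x ∈ M.tube) : M.H (M.toX x) = stdH x := by
  rw [toX, dif_pos hx, eqvGen_stdH (exists_preX hx).choose_spec]
  rfl

lemma act_mem_tube {w : ℂ} (hw : w ≠ 0) {x : E} (hx : x ∈ M.tube) : act w x ∈ M.tube := by
  rw [mem_tube_iff, stdH_act hw, ← mem_tube_iff]; exact hx

/-! ### The action of `ℂ^*` on `X_S` -/

variable (M) in
/-- The action of `ℂ^*` on `X_S` induced by the one on the tube. -/
def smulX (w : ℂ) (x : M.X) : M.X := M.toX (act w (toX_surj x).choose)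

/-- Independence of the representative chosen in `smulX`, by equivariance of the steps. -/
lemma smulX_toX {w : ℂ} (hw : w ≠ 0) {x : E} (hx : x ∈ M.tube) :
    M.smulX w (M.toX x) = M.toX (act w x) := by
  obtain ⟨h1, h2⟩ := (toX_surj (M.toX x)).choose_spec
  rw [smulX, toX_eq_iff (act_mem_tube hw h1) (act_mem_tube hw hx)]
  exact eqvGen_act ((toX_eq_iff h1 hx).1 h2) hw

lemma smulX_mul {v w : ℂ} (hv : v ≠ 0) (hw : w ≠ 0) (x : M.X) :
    M.smulX (v * w) x = M.smulX v (M.smulX w x) := by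
  obtain ⟨y, hy, rfl⟩ := toX_surj x
  rw [smulX_toX hw hy, smulX_toX hv (act_mem_tube hw hy), smulX_toX (mul_ne_zero hv hw) hy, act_mul]

lemma smulX_one (x : M.X) : M.smulX 1 x = x := by
  obtain ⟨y, hy, rfl⟩ := toX_surj x
  rw [smulX_toX one_ne_zero hy, act_one]

lemma H_smulX {w : ℂ} (hw : w ≠ 0) (x : M.X) : M.H (M.smulX w x) = M.H x := by
  obtain ⟨y, hy, rfl⟩ := toX_surj x
  rw [smulX_toX hw hy, H_toX hy, H_toX (act_mem_tube hw hy), stdH_act hw]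

lemma smulX_s {w : ℂ} (hw : w ≠ 0) : M.smulX w M.s = M.s := by
  rw [← toX_zero, smulX_toX hw zero_mem_tube, act_zero_right]

/-! ### Smoothness -/

lemma toX_eq_chartAt_symm (x : M.X) {z : E} (hz : z ∈ (chartAt E x).target) :
    z ∈ M.tube ∧ M.toX z = (chartAt E x).symm z := by
  have : chartAt E x = M.chart₀ ∨ chartAt E x = M.chart₁ := chart_mem_atlas E x
  rcases this with h | h <;> rw [h] at hz ⊢
  · rw [chart₀_target] at hz
    exact ⟨hz.1, (toX_eq_proj ⟨z, M.dom₀_subset hz⟩).trans (M.chart₀_symm ⟨z, hz⟩).symm⟩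
  · rw [chart₁_target] at hz
    exact ⟨hz.1, (toX_eq_proj ⟨z, M.dom₁_subset hz⟩).trans (M.chart₁_symm ⟨z, hz⟩).symm⟩

lemma toX_chartAt (x : M.X) {y : M.X} (hy : y ∈ (chartAt E x).source) :
    chartAt E x y ∈ M.tube ∧ M.toX (chartAt E x y) = y := by
  have h := toX_eq_chartAt_symm x ((chartAt E x).map_source hy)
  rwa [(chartAt E x).left_inv hy] at h

lemma chartAt_toX (x : M.X) {z : E} (hz : z ∈ (chartAt E x).target) :
    chartAt E x (M.toX z) = z := by
  rw [(toX_eq_chartAt_symm x hz).2, (chartAt E x).right_inv hz]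

lemma contMDiffAt_toX_of_target (x : M.X) {z : E} (hz : z ∈ (chartAt E x).target) :
    ContMDiffAt 𝓘(ℝ, E) 𝓘(ℝ, E) ∞ M.toX z := by
  have h := (contMDiffOn_chart_symm (I := 𝓘(ℝ, E)) (n := ∞) (x := x)).contMDiffAt
    ((chartAt E x).open_target.mem_nhds hz)
  refine h.congr_of_eventuallyEq ?_
  filter_upwards [(chartAt E x).open_target.mem_nhds hz] with y hy
  exact (toX_eq_chartAt_symm x hy).2

lemma toX_glueMap {x : E} (hx : x ∈ M.tube) (hq : x.2 ≠ 0) : M.toX (M.glueMap x) = M.toX x :=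
  have hs : M.Step x (M.glueMap x) := ⟨hx, hq, rfl⟩
  (toX_eq_iff hs.right_mem hx).2 (.symm _ _ (.rel _ _ hs))

lemma toX_glueInv {x : E} (hx : x ∈ M.tube) (hp : x.1 ≠ 0) : M.toX (M.glueInv x) = M.toX x :=
  have hs := step_glueInv hx hp
  (toX_eq_iff hs.1 hx).2 (.rel _ _ hs)

lemma Step.contMDiffAt_toX_iff {x y : E} (h : M.Step x y) :
    ContMDiffAt 𝓘(ℝ, E) 𝓘(ℝ, E) ∞ M.toX x ↔ ContMDiffAt 𝓘(ℝ, E) 𝓘(ℝ, E) ∞ M.toX y := by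
  have hx : x ∈ M.tube ∩ {x | x.2 ≠ 0} := ⟨h.1, h.2.1⟩
  have hy : y ∈ M.tube ∩ {x | x.1 ≠ 0} := ⟨h.right_mem, h.fst_ne⟩
  constructor
  · intro hs
    have hg := M.contDiffOn_glueInv.contDiffAt (M.isOpen_tube_fst.mem_nhds hy)
    rw [h.eq_glueInv] at hs
    refine (hs.comp y hg.contMDiffAt).congr_of_eventuallyEq ?_
    filter_upwards [M.isOpen_tube_fst.mem_nhds hy] with z hz
    exact (toX_glueInv hz.1 hz.2).symm
  · intro hs
    have hg := M.contDiffOn_glueMap.contDiffAt (M.isOpen_tube_snd.mem_nhds hx)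
    rw [h.2.2] at hs
    refine (hs.comp x hg.contMDiffAt).congr_of_eventuallyEq ?_
    filter_upwards [M.isOpen_tube_snd.mem_nhds hx] with z hz
    exact (toX_glueMap hz.1 hz.2).symm

/-- On the target of a chart `toX` is the inverse chart. Steps are local diffeomorphisms that leave
`toX` unchanged, so smoothness spreads along each orbit, and every orbit meets such a target. -/
lemma contMDiffAt_toX {x : E} (hx : x ∈ M.tube) :
    ContMDiffAt 𝓘(ℝ, E) 𝓘(ℝ, E) ∞ M.toX x := by
  have key : ∀ {x y : E}, EqvGen M.Step x y →
      (ContMDiffAt 𝓘(ℝ, E) 𝓘(ℝ, E) ∞ M.toX x ↔ ContMDiffAt 𝓘(ℝ, E) 𝓘(ℝ, E) ∞ M.toX y) := by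
    intro x y h
    induction h with
    | rel _ _ h => exact h.contMDiffAt_toX_iff
    | refl => rfl
    | symm _ _ _ ih => exact ih.symm
    | trans _ _ _ _ _ h1 h2 => exact h1.trans h2
  obtain ⟨h1, h2⟩ := toX_chartAt (M.toX x) (mem_chart_source E (M.toX x))
  rw [← key ((toX_eq_iff h1 hx).1 h2)]
  exact contMDiffAt_toX_of_target (M.toX x) (mem_chart_target E _)

/-- Locally the action is chart, then `act`, then `toX`. The moved point may leave the chart, but it
stays in the tube, where `toX` is smooth. -/
lemma contMDiffAt_smulX {w : ℂ} (hw : w ≠ 0) (x : M.X) :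
    ContMDiffAt (𝓘(ℝ, ℂ).prod 𝓘(ℝ, E)) 𝓘(ℝ, E) ∞ (fun a : ℂ × M.X => M.smulX a.1 a.2) (w, x) := by
  have hx := mem_chart_source E x
  have h1 : ContMDiffAt (𝓘(ℝ, ℂ).prod 𝓘(ℝ, E)) 𝓘(ℝ, E) ∞
      (fun a : ℂ × M.X => chartAt E x a.2) (w, x) :=
    ((contMDiffOn_chart (I := 𝓘(ℝ, E)) (n := ∞) (x := x)).contMDiffAt
      ((chartAt E x).open_source.mem_nhds hx)).comp (w, x) contMDiffAt_snd
  have h2 : ContMDiffAt (𝓘(ℝ, ℂ).prod 𝓘(ℝ, E)) 𝓘(ℝ, ℂ × E) ∞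
      (fun a : ℂ × M.X => (a.1, chartAt E x a.2)) (w, x) := contMDiffAt_fst.prodMk_space h1
  have h3 := (contDiffAt_act (z := (w, chartAt E x x)) hw).contMDiffAt.comp (w, x) h2
  have h4 := (contMDiffAt_toX (act_mem_tube hw (toX_chartAt x hx).1)).comp (w, x) h3
  refine h4.congr_of_eventuallyEq ?_
  have h5 : ∀ᶠ a : ℂ × M.X in 𝓝 (w, x), a.1 ≠ 0 ∧ a.2 ∈ (chartAt E x).source :=
    (continuousAt_fst.eventually_ne hw).and
      (continuousAt_snd.preimage_mem_nhds ((chartAt E x).open_source.mem_nhds hx))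
  filter_upwards [h5] with a ha
  obtain ⟨h6, h7⟩ := toX_chartAt x ha.2
  change M.smulX a.1 a.2 = M.toX (act a.1 (chartAt E x a.2))
  rw [← smulX_toX ha.1 h6, h7]

end Model

/-! ### The infinitesimal generator and its expression in charts -/

/-- The infinitesimal generator `(κ p, -κ̄ q)` of the action of `e^{κ t}` on `ℂ²`. -/
def gen (κ : ℂ) (x : E) : E := (κ * x.1, -conj κ * x.2)

lemma hasDerivAt_exp_mul (a : ℂ) (t : ℝ) :
    HasDerivAt (fun t : ℝ => Complex.exp (a * t)) (a * Complex.exp (a * t)) t := by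
  have h1 : HasDerivAt (fun t : ℝ => a * (t : ℂ)) a t := by
    simpa using (Complex.ofRealCLM.hasDerivAt (x := t)).const_mul a
  simpa [mul_comm] using h1.cexp

lemma hasDerivAt_act_exp (κ : ℂ) (t : ℝ) (x : E) :
    HasDerivAt (fun t : ℝ => act (Complex.exp (κ * t)) x) (gen κ (act (Complex.exp (κ * t)) x))
      t := by
  have hq : ∀ t : ℝ, x.2 / conj (Complex.exp (κ * t)) = Complex.exp (-conj κ * t) * x.2 := by
    intro t
    rw [← Complex.exp_conj, map_mul, Complex.conj_ofReal, neg_mul, Complex.exp_neg]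
    field_simp
  have h1 := ((hasDerivAt_exp_mul κ t).mul_const x.1).prodMk ((hasDerivAt_exp_mul (-conj κ) t).mul_const x.2)
  simp only [act, gen, hq]
  simpa only [mul_assoc] using h1

/-- The action by `e^{-κ t}` makes a solution of the differential equation of the generator
constant. -/
lemma hasDerivAt_act_exp_neg {κ : ℂ} {u : ℝ → E} {t : ℝ} (hu : HasDerivAt u (gen κ (u t)) t) :
    HasDerivAt (fun t : ℝ => act (Complex.exp (-κ * t)) (u t)) 0 t := by
  have hq : ∀ t : ℝ, (u t).2 / conj (Complex.exp (-κ * t)) = Complex.exp (conj κ * t) * (u t).2 := by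
    intro t
    rw [← Complex.exp_conj, map_mul, Complex.conj_ofReal, map_neg, neg_mul, Complex.exp_neg]
    field_simp
  have hu1 : HasDerivAt (fun t => (u t).1) (κ * (u t).1) t :=
    (hasFDerivAt_fst (𝕜 := ℝ) (p := u t)).comp_hasDerivAt t hu
  have hu2 : HasDerivAt (fun t => (u t).2) (-conj κ * (u t).2) t :=
    (hasFDerivAt_snd (𝕜 := ℝ) (p := u t)).comp_hasDerivAt t hu
  have h1 := ((hasDerivAt_exp_mul (-κ) t).mul hu1).prodMk ((hasDerivAt_exp_mul (conj κ) t).mul hu2)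
  have h2 : (fun t : ℝ => act (Complex.exp (-κ * t)) (u t)) =
      fun t : ℝ => (Complex.exp (-κ * t) * (u t).1, Complex.exp (conj κ * t) * (u t).2) :=
    funext fun t => Prod.ext rfl (hq t)
  rw [h2]
  refine h1.congr_deriv (Prod.ext ?_ ?_)
  · change _ = (0 : ℂ); ring
  · change _ = (0 : ℂ); ring

lemma hasFDerivAt_stdH (x : E) : ∃ L : E →L[ℝ] ℂ, HasFDerivAt stdH L x ∧
    ∀ v, L v = -(conj v.1 * x.2 + conj x.1 * v.2) := by
  have hc : HasFDerivAt (fun z : E => conj z.1)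
      ((Complex.conjCLE : ℂ →L[ℝ] ℂ).comp (ContinuousLinearMap.fst ℝ ℂ ℂ)) x :=
    ((Complex.conjCLE : ℂ →L[ℝ] ℂ).comp (ContinuousLinearMap.fst ℝ ℂ ℂ)).hasFDerivAt
  have h := (hc.mul (hasFDerivAt_snd (𝕜 := ℝ) (p := x))).neg
  refine ⟨_, h, fun v => ?_⟩
  simp
  ring

namespace Model

variable {M : Model}

/-- For short times the linear orbit stays in the target of the chart, where `toX` inverts the
chart. -/
lemma smulX_eventually_chart {γ : ℝ → M.X} {κ : ℂ} {t₀ : ℝ}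
    (hγ : ∀ t, γ t = M.smulX (Complex.exp (κ * (t - t₀))) (γ t₀)) (x : M.X)
    (hx : γ t₀ ∈ (chartAt E x).source) :
    ∀ᶠ t in 𝓝 t₀, γ t ∈ (chartAt E x).source ∧
      chartAt E x (γ t) = act (Complex.exp (κ * ((t - t₀ : ℝ) : ℂ))) (chartAt E x (γ t₀)) := by
  obtain ⟨h1, h2⟩ := toX_chartAt x hx
  have hc : ContinuousAt
      (fun t : ℝ => act (Complex.exp (κ * ((t - t₀ : ℝ) : ℂ))) (chartAt E x (γ t₀))) t₀ := by
    have h := (hasDerivAt_act_exp κ (t₀ - t₀) (chartAt E x (γ t₀))).continuousAt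
    exact h.comp (f := fun t : ℝ => t - t₀) (by fun_prop)
  have h0 : act (Complex.exp (κ * ((t₀ - t₀ : ℝ) : ℂ))) (chartAt E x (γ t₀))
      ∈ (chartAt E x).target := by
    simpa using (chartAt E x).map_source hx
  filter_upwards [hc.preimage_mem_nhds ((chartAt E x).open_target.mem_nhds h0)] with t ht
  have h3 : γ t = M.toX (act (Complex.exp (κ * ((t - t₀ : ℝ) : ℂ))) (chartAt E x (γ t₀))) := by
    rw [hγ t, ← smulX_toX (Complex.exp_ne_zero _) h1, h2]
    push_cast
    rfl
  rw [h3]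
  refine ⟨?_, chartAt_toX x ht⟩
  rw [(toX_eq_chartAt_symm x ht).2]
  exact (chartAt E x).map_target ht

lemma hasDerivAt_chart_smulX {γ : ℝ → M.X} {κ : ℂ} {t₀ : ℝ}
    (hγ : ∀ t, γ t = M.smulX (Complex.exp (κ * (t - t₀))) (γ t₀)) (x : M.X)
    (hx : γ t₀ ∈ (chartAt E x).source) :
    HasDerivAt (fun t => chartAt E x (γ t)) (gen κ (chartAt E x (γ t₀))) t₀ := by
  have h := HasDerivAt.scomp (h := fun t : ℝ => t - t₀) t₀
    (hasDerivAt_act_exp κ (t₀ - t₀) (chartAt E x (γ t₀))) ((hasDerivAt_id t₀).sub_const t₀)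
  simp only [one_smul, sub_self, Complex.ofReal_zero, mul_zero, Complex.exp_zero, act_one] at h
  exact h.congr_of_eventuallyEq ((smulX_eventually_chart hγ x hx).mono fun t ht => ht.2)

/-- Both coordinate expressions of the generator correspond under the change of charts. -/
lemma tangentCoordChange_gen (κ : ℂ) (x y : M.X) (hx : x ∈ (chartAt E y).source) :
    tangentCoordChange 𝓘(ℝ, E) x y x (gen κ (chartAt E x x)) = gen κ (chartAt E y x) := by
  -- The orbit of `x` has velocity `gen κ` in both charts; the chain rule for the transition map
  -- compares the two.
  set γ : ℝ → M.X := fun t => M.smulX (Complex.exp (κ * t)) x with hγdef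
  have h0 : γ 0 = x := by simp [γ, smulX_one]
  have hγ : ∀ t, γ t = M.smulX (Complex.exp (κ * (t - (0 : ℝ)))) (γ 0) := by
    intro t; simp [h0, γ]
  have h1 := hasDerivAt_chart_smulX hγ x (by rw [h0]; exact mem_chart_source E x)
  have h2 := hasDerivAt_chart_smulX hγ y (by rwa [h0])
  have h3 := (hasFDerivWithinAt_tangentCoordChange (I := 𝓘(ℝ, E)) (x := x) (y := y) (z := x)
    ⟨by simp, by simpa using hx⟩)
  simp only [modelWithCornersSelf_coe, range_id, hasFDerivWithinAt_univ] at h3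
  have h4 : HasFDerivAt (extChartAt 𝓘(ℝ, E) y ∘ (extChartAt 𝓘(ℝ, E) x).symm)
      (tangentCoordChange 𝓘(ℝ, E) x y x) (chartAt E x (γ 0)) := by rw [h0]; exact h3
  have h5 := h4.comp_hasDerivAt 0 h1
  rw [h0] at h2 h5
  refine (h5.congr_of_eventuallyEq ?_).unique h2 |>.symm ▸ rfl
  have := smulX_eventually_chart hγ x (by rw [h0]; exact mem_chart_source E x)
  filter_upwards [this] with t ht
  simp [ht.1]

/-! ### The Hamiltonian flows -/

/-- In every chart `H` is `stdH`. The functional `l` stands for the real or the imaginary part, so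
that one computation serves both Hamiltonians. -/
lemma mfderiv_comp_H (l : ℂ →L[ℝ] ℝ) (x : M.X) (v : E) :
    (mfderiv 𝓘(ℝ, E) 𝓘(ℝ, ℝ) (fun x => l (M.H x)) x v : ℝ) =
      l (-(conj v.1 * (chartAt E x x).2 + conj (chartAt E x x).1 * v.2)) := by
  obtain ⟨L, hL, hv⟩ := hasFDerivAt_stdH (chartAt E x x)
  have h1 : (fun z => l (M.H ((chartAt E x).symm z))) =ᶠ[𝓝 (chartAt E x x)] l ∘ stdH := by
    filter_upwards [(chartAt E x).open_target.mem_nhds (mem_chart_target E x)] with z hz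
    obtain ⟨h2, h3⟩ := toX_eq_chartAt_symm x hz
    rw [← h3, H_toX h2, Function.comp_apply]
  have h2 := ((l.hasFDerivAt (x := stdH (chartAt E x x))).comp _ hL).congr_of_eventuallyEq h1
  have hcont : ContinuousAt (fun x => l (M.H x)) x := by
    have h3 := h2.continuousAt.comp (f := chartAt E x)
      ((chartAt E x).continuousAt (mem_chart_source E x))
    refine h3.congr ?_
    filter_upwards [(chartAt E x).open_source.mem_nhds (mem_chart_source E x)] with z hz
    simp [(chartAt E x).left_inv hz]
  have h4 : HasMFDerivAt 𝓘(ℝ, E) 𝓘(ℝ, ℝ) (fun x => l (M.H x)) x (l.comp L) := by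
    refine ⟨hcont, ?_⟩
    exact h2.hasFDerivWithinAt
  rw [h4.mfderiv]
  exact congrArg l (hv v)

lemma hamVF_re (x : M.X) : M.hamVF (fun x => (M.H x).re) x = gen 1 (chartAt E x x) := by
  have h := mfderiv_comp_H (M := M) Complex.reCLM x
  simp only [Complex.reCLM_apply] at h
  exact Prod.ext
    (Complex.ext ((congrArg Neg.neg (h (0, 1))).trans (by simp [gen]; exact neg_neg _))
      ((congrArg Neg.neg (h (0, Complex.I))).trans (by simp [gen]; exact neg_neg _)))
    (Complex.ext ((h (1, 0)).trans (by simp [gen]; rfl)) ((h (Complex.I, 0)).trans (by simp [gen]; rfl)))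

lemma hamVF_im (x : M.X) : M.hamVF (fun x => (M.H x).im) x = gen Complex.I (chartAt E x x) := by
  have h := mfderiv_comp_H (M := M) Complex.imCLM x
  simp only [Complex.imCLM_apply] at h
  exact Prod.ext
    (Complex.ext ((congrArg Neg.neg (h (0, 1))).trans (by simp [gen]; rfl))
      ((congrArg Neg.neg (h (0, Complex.I))).trans (by simp [gen]; exact neg_neg _)))
    (Complex.ext ((h (1, 0)).trans (by simp [gen]; rfl)) ((h (Complex.I, 0)).trans (by simp [gen]; rfl)))

/-- Orbits of the action are integral curves for all time. Conversely, along an integral curve `γ`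
the point `e^{-κ t} · γ(t)` is locally constant, hence constant because `ℝ` is connected. This gives
uniqueness without using that `X_S` is Hausdorff. -/
lemma flowsTo_iff_of_hamVF {f : M.X → ℝ} {κ : ℂ}
    (hf : ∀ x, M.hamVF f x = gen κ (chartAt E x x)) (t : ℝ) (x y : M.X) :
    M.FlowsTo f t x y ↔ y = M.smulX (Complex.exp (κ * t)) x := by
  constructor
  · rintro ⟨γ, hγ, rfl, rfl⟩
    have hloc : IsLocallyConstant (fun t : ℝ => M.smulX (Complex.exp (-κ * t)) (γ t)) := by
      rw [IsLocallyConstant.iff_eventually_eq]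
      intro t₀
      have hu : ∀ᶠ t in 𝓝 t₀, HasDerivAt (fun t => chartAt E (γ t₀) (γ t))
          (gen κ (chartAt E (γ t₀) (γ t))) t := by
        have h1 := (hγ.isMIntegralCurveAt t₀).eventually_hasDerivAt
        have h2 := hγ.continuous.continuousAt.preimage_mem_nhds
          ((chartAt E (γ t₀)).open_source.mem_nhds (mem_chart_source E (γ t₀)))
        filter_upwards [h1, h2] with t ht ht2
        -- The velocity at time `t` is given in the preferred chart at `γ t`; this rewrites it in
        -- the fixed chart at `γ t₀`.
        rw [hf, tangentCoordChange_gen κ _ _ ht2] at ht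
        exact ht
      have h2 := hγ.continuous.continuousAt.preimage_mem_nhds
          ((chartAt E (γ t₀)).open_source.mem_nhds (mem_chart_source E (γ t₀)))
      obtain ⟨r, hr, hball⟩ := Metric.eventually_nhds_iff_ball.1 (hu.and h2)
      filter_upwards [ball_mem_nhds t₀ hr] with t ht
      have h3 : ∀ s ∈ ball t₀ r, M.smulX (Complex.exp (-κ * s)) (γ s)
          = M.toX (act (Complex.exp (-κ * s)) (chartAt E (γ t₀) (γ s))) := by
        intro s hs
        obtain ⟨h4, h5⟩ := toX_chartAt (γ t₀) (hball s hs).2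
        rw [← smulX_toX (Complex.exp_ne_zero _) h4, h5]
      rw [h3 t ht, h3 t₀ (mem_ball_self hr)]
      congr 1
      refine isOpen_ball.is_const_of_deriv_eq_zero (convex_ball t₀ r).isPreconnected
        (fun s hs => (hasDerivAt_act_exp_neg (hball s hs).1).differentiableAt.differentiableWithinAt)
        (fun s hs => (hasDerivAt_act_exp_neg (hball s hs).1).deriv) ht (mem_ball_self hr)
    have h := hloc.apply_eq_of_isPreconnected isPreconnected_univ (mem_univ t) (mem_univ (0 : ℝ))
    simp only [Complex.ofReal_zero, mul_zero, Complex.exp_zero, smulX_one] at h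
    rw [← h, ← smulX_mul (Complex.exp_ne_zero _) (Complex.exp_ne_zero _), ← Complex.exp_add]
    simp [smulX_one]
  · rintro rfl
    refine ⟨fun t => M.smulX (Complex.exp (κ * t)) x, fun t₀ => ?_, by simp [smulX_one], rfl⟩
    have hγ : ∀ t : ℝ, M.smulX (Complex.exp (κ * t)) x = M.smulX (Complex.exp (κ * (t - t₀)))
        (M.smulX (Complex.exp (κ * t₀)) x) := by
      intro t
      rw [← smulX_mul (Complex.exp_ne_zero _) (Complex.exp_ne_zero _), ← Complex.exp_add]
      congr 2; ring
    set γ : ℝ → M.X := fun t => M.smulX (Complex.exp (κ * t)) x with hγdef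
    have h1 := hasDerivAt_chart_smulX (γ := γ) hγ (γ t₀) (mem_chart_source E _)
    have h2 := smulX_eventually_chart (γ := γ) hγ (γ t₀) (mem_chart_source E _)
    refine ⟨?_, ?_⟩
    · have h3 := ContinuousAt.comp (f := fun t => chartAt E (γ t₀) (γ t))
        ((chartAt E (γ t₀)).continuousAt_symm (mem_chart_target E (γ t₀))) h1.continuousAt
      refine h3.congr ?_
      filter_upwards [h2] with t ht
      simp [(chartAt E (γ t₀)).left_inv ht.1]
    · rw [hf]
      exact h1.hasDerivWithinAt.hasFDerivWithinAt

lemma jointFlowsTo_iff (t : ℝ × ℝ) (x y : M.X) :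
    M.JointFlowsTo t x y ↔ y = M.smulX (Complex.exp (t.1 + t.2 * Complex.I)) x := by
  simp only [JointFlowsTo, flowsTo_iff_of_hamVF hamVF_re, flowsTo_iff_of_hamVF hamVF_im,
    exists_eq_left]
  rw [← smulX_mul (Complex.exp_ne_zero _) (Complex.exp_ne_zero _), ← Complex.exp_add]
  rw [one_mul, mul_comm Complex.I]

/-! ### Position of a point relative to the section -/

lemma σ₂_mem_tube {b : ℂ} (hb : b ∈ ball (0 : ℂ) M.ε) : σ₂ b ∈ M.tube := (M.σ₂_mem hb).1

lemma secS_eq_toX_σ₂ (b : ball (0 : ℂ) M.ε) : M.secS b = M.toX (σ₂ b) :=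
  (toX_eq_proj ⟨σ₂ b, M.σ₂_mem b.2⟩).symm

lemma secS_eq_toX_σ₁ (b : ball (0 : ℂ) M.ε) : M.secS b = M.toX (M.σ₁ b) := by
  have h := M.glueMap_flow 0 0 b
  have h0 : ∀ x, stdFlow 0 0 x = x := fun x => by simp [stdFlow]
  rw [h0, h0] at h
  rw [secS_eq_toX_σ₂, ← h, toX_glueMap (σ₂_mem_tube b.2) (by simp [σ₂])]

variable (M) in
/-- The point of the section in the fiber of `x`. -/
def base (x : M.X) : M.X := M.secS ⟨M.H x, M.H_mem x⟩

lemma base_eq_of_H_eq {x y : M.X} (h : M.H x = M.H y) : M.base x = M.base y := by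
  simp only [base, h]

/-- If `q ≠ 0`, the value of `stdH` and `q` determine `p`, so it suffices to move the coordinate `q
= 1` of `σ₂` to the right value. -/
lemma smulX_base_of_snd_ne {x : E} (hx : x ∈ M.tube) (hq : x.2 ≠ 0) :
    M.smulX (1 / conj x.2) (M.base (M.toX x)) = M.toX x := by
  have h1 : conj x.2 ≠ 0 := by simpa using hq
  rw [base, secS_eq_toX_σ₂, smulX_toX (one_div_ne_zero h1) (σ₂_mem_tube (M.H_mem _))]
  congr 1
  simp only [H_toX hx, act, σ₂, stdH]
  ext1
  · simp only [map_neg, map_mul, Complex.conj_conj]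
    field_simp
  · simp

/-- The counterpart with `σ₁`, whose first coordinate is `e^{S₁ + i S₂}`; it covers the points with
`q = 0`. -/
lemma smulX_base_of_fst_ne {x : E} (hx : x ∈ M.tube) (hp : x.1 ≠ 0) :
    M.smulX (x.1 / M.eS (stdH x)) (M.base (M.toX x)) = M.toX x := by
  have h1 : conj x.1 ≠ 0 := by simpa using hp
  have h2 := M.eS_ne (stdH x)
  have h3 : conj (M.eS (stdH x)) ≠ 0 := by simpa using h2
  have h4 : M.σ₁ (stdH x) = (M.eS (stdH x), -(stdH x) / conj (M.eS (stdH x))) := by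
    rw [σ₁, stdFlow, eS, conj_exp]
    ext1 <;> simp [div_eq_mul_inv, mul_comm]
  have h5 : M.σ₁ (stdH x) ∈ M.tube := by
    rw [mem_tube_iff, M.stdH_σ₁, ← mem_tube_iff]; exact hx
  rw [base, secS_eq_toX_σ₁]
  simp only [H_toX hx]
  rw [smulX_toX (div_ne_zero hp h2) h5, h4]
  congr 1
  ext1
  · simp only [act]
    field_simp
  · simp only [act, map_div₀]
    conv_lhs => rw [show -stdH x = conj x.1 * x.2 by simp [stdH]]
    field_simp

open Relation in
-- The origin is alone in its orbit: steps start at `q ≠ 0` and end at `p ≠ 0`.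
lemma toX_eq_s_iff {x : E} (hx : x ∈ M.tube) : M.toX x = M.s ↔ x = 0 := by
  refine ⟨fun h => ?_, fun h => h ▸ toX_zero⟩
  rw [← toX_zero, toX_eq_iff hx zero_mem_tube] at h
  rcases Step.reflTransGen_or h with h | h
  · rcases h.cases_tail with h | ⟨z, -, h⟩
    · exact h.symm
    · exact (h.fst_ne rfl).elim
  · rcases h.cases_head with h | ⟨z, h, -⟩
    · exact h.symm
    · exact (h.2.1 rfl).elim

lemma base_ne_s (x : M.X) : M.base x ≠ M.s := by
  rw [base, secS_eq_toX_σ₂, Ne, toX_eq_s_iff (σ₂_mem_tube (M.H_mem _))]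
  exact fun h => one_ne_zero (congrArg Prod.snd h)

lemma smulX_inv_smulX {w : ℂ} (hw : w ≠ 0) (x : M.X) : M.smulX w⁻¹ (M.smulX w x) = x := by
  rw [← smulX_mul (inv_ne_zero hw) hw, inv_mul_cancel₀ hw, smulX_one]

lemma smulX_ne_s {w : ℂ} (hw : w ≠ 0) {x : M.X} (hx : x ≠ M.s) : M.smulX w x ≠ M.s := by
  intro h
  apply hx
  rw [← smulX_inv_smulX hw x, h, smulX_s (inv_ne_zero hw)]

/-- Away from `s`, the position of a point relative to the section is locally given by a smooth
function. -/
lemma exists_contMDiffOn_smulX_base {x₀ : M.X} (hx₀ : x₀ ≠ M.s) :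
    ∃ u : M.X → ℂ, ∃ U : Set M.X, IsOpen U ∧ x₀ ∈ U ∧ ContMDiffOn 𝓘(ℝ, E) 𝓘(ℝ, ℂ) ∞ u U ∧
      ∀ x ∈ U, u x ≠ 0 ∧ M.smulX (u x) (M.base x) = x := by
  set e := chartAt E x₀ with he
  have hsrc : x₀ ∈ e.source := mem_chart_source E x₀
  have hs : ContMDiffOn 𝓘(ℝ, E) 𝓘(ℝ, E) ∞ e e.source := contMDiffOn_chart
  have h0 := toX_chartAt x₀ hsrc
  by_cases hq : (e x₀).2 = 0
  · have hp : (e x₀).1 ≠ 0 := by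
      intro hp
      apply hx₀
      rw [← h0.2, toX_eq_s_iff h0.1]
      exact Prod.ext hp hq
    refine ⟨fun x => (e x).1 / M.eS (stdH (e x)), e.source ∩ e ⁻¹' (M.tube ∩ {z | z.1 ≠ 0}),
      e.continuousOn.isOpen_inter_preimage e.open_source M.isOpen_tube_fst,
      ⟨hsrc, h0.1, hp⟩, ?_, ?_⟩
    · have h1 : ContDiffOn ℝ ∞ (fun z : E => z.1 / M.eS (stdH z)) (M.tube ∩ {z | z.1 ≠ 0}) := by
        simp only [div_eq_mul_inv]
        exact contDiff_fst.contDiffOn.mul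
          ((M.contDiffOn_eS.mono inter_subset_left).inv fun x _ => M.eS_ne _)
      exact h1.contMDiffOn.comp (hs.mono inter_subset_left) fun x hx => hx.2
    · rintro x ⟨hx, h1, h2⟩
      refine ⟨div_ne_zero h2 (M.eS_ne _), ?_⟩
      have h3 := smulX_base_of_fst_ne h1 h2
      rwa [(toX_chartAt x₀ hx).2] at h3
  · refine ⟨fun x => 1 / conj (e x).2, e.source ∩ e ⁻¹' (M.tube ∩ {z | z.2 ≠ 0}),
      e.continuousOn.isOpen_inter_preimage e.open_source M.isOpen_tube_snd,
      ⟨hsrc, h0.1, hq⟩, ?_, ?_⟩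
    · have h1 : ContDiffOn ℝ ∞ (fun z : E => 1 / conj z.2) (M.tube ∩ {z | z.2 ≠ 0}) := by
        simp only [one_div]
        exact (contDiff_conj.comp contDiff_snd).contDiffOn.inv fun x hx => by simpa using hx.2
      exact h1.contMDiffOn.comp (hs.mono inter_subset_left) fun x hx => hx.2
    · rintro x ⟨hx, h1, h2⟩
      refine ⟨one_div_ne_zero (by simpa using h2), ?_⟩
      have h3 := smulX_base_of_snd_ne h1 h2
      rwa [(toX_chartAt x₀ hx).2] at h3

lemma exists_smulX_base {x : M.X} (hx : x ≠ M.s) : ∃ w : ℂ, w ≠ 0 ∧ M.smulX w (M.base x) = x := by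
  obtain ⟨u, U, -, hxU, -, h⟩ := exists_contMDiffOn_smulX_base hx
  exact ⟨u x, h x hxU⟩

/-! ### Fiberwise addition -/

open Classical in
variable (M) in
/-- A number `w` with `w · σ_S(H(x)) = x`, for `x ≠ s`. -/
def pos (x : M.X) : ℂ := if hx : x ≠ M.s then (exists_smulX_base hx).choose else 1

lemma pos_ne_zero (x : M.X) : M.pos x ≠ 0 := by
  rw [pos]
  split_ifs with hx
  · exact (exists_smulX_base hx).choose_spec.1
  · exact one_ne_zero

lemma smulX_pos {x : M.X} (hx : x ≠ M.s) : M.smulX (M.pos x) (M.base x) = x := by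
  rw [pos, dif_pos hx]
  exact (exists_smulX_base hx).choose_spec.2

lemma smulX_comm {v w : ℂ} (hv : v ≠ 0) (hw : w ≠ 0) (x : M.X) :
    M.smulX v (M.smulX w x) = M.smulX w (M.smulX v x) := by
  rw [← smulX_mul hv hw, ← smulX_mul hw hv, mul_comm]

/-- If `x = v · σ` and `y = w · σ` then `w · x = v · y`. -/
lemma smulX_swap {x y : M.X} {v w : ℂ} (hv : v ≠ 0) (hw : w ≠ 0) (hH : M.H x = M.H y)
    (hx : M.smulX v (M.base x) = x) (hy : M.smulX w (M.base y) = y) :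
    M.smulX w x = M.smulX v y := by
  conv_lhs => rw [← hx]
  conv_rhs => rw [← hy]
  rw [smulX_comm hw hv, base_eq_of_H_eq hH]

/-- Numbers moving the section to the same point act in the same way on the fiber. -/
lemma smulX_eq_smulX {x y : M.X} {v w : ℂ} (hv : v ≠ 0) (hw : w ≠ 0) (hH : M.H x = M.H y)
    (h : M.smulX v (M.base y) = M.smulX w (M.base y)) : M.smulX v x = M.smulX w x := by
  by_cases hx : x = M.s
  · rw [hx, smulX_s hv, smulX_s hw]
  · rw [← smulX_pos hx, smulX_comm hv (pos_ne_zero x), smulX_comm hw (pos_ne_zero x),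
      base_eq_of_H_eq hH, h]

open Classical in
variable (M) in
/-- The fiberwise addition. -/
def add (a : M.X × M.X) : M.X :=
  -- The singular point has no position, so the other summand has to act. At the excluded pair `(s,
  -- s)` the default `pos s = 1` gives the value `s`.
  if a.2 = M.s then M.smulX (M.pos a.1) a.2 else M.smulX (M.pos a.2) a.1

lemma add_eq_right {x y : M.X} {w : ℂ} (hw : w ≠ 0) (hy : y ≠ M.s) (hH : M.H x = M.H y)
    (h : M.smulX w (M.base y) = y) : M.add (x, y) = M.smulX w x := by
  rw [add, if_neg hy]
  exact smulX_eq_smulX (pos_ne_zero y) hw hH ((smulX_pos hy).trans h.symm)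

lemma add_eq_left {x y : M.X} {v : ℂ} (hv : v ≠ 0) (hH : M.H x = M.H y)
    (h : M.smulX v (M.base x) = x) : M.add (x, y) = M.smulX v y := by
  by_cases hy : y = M.s
  · subst hy
    rw [add, if_pos rfl, smulX_s (pos_ne_zero x), smulX_s hv]
  · rw [add, if_neg hy]
    exact smulX_swap hv (pos_ne_zero y) hH h (smulX_pos hy)

lemma ne_s_of_smulX_base {x : M.X} {w : ℂ} (hw : w ≠ 0) (h : M.smulX w (M.base x) = x) :
    x ≠ M.s := h ▸ smulX_ne_s hw (base_ne_s x)

/-- The chosen `pos` need not be continuous. Near a pair in the fiber product one entry differs from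
`s`; the smooth local position `u` of that entry acts on the other one. This formula is smooth on an
open subset of `X_S × X_S` and agrees with `add` where the fibers coincide. -/
lemma smoothAlong_add : M.SmoothAlong M.add M.fiberProd := by
  rintro ⟨x₀, y₀⟩ ⟨hH₀, hne⟩
  by_cases hy₀ : y₀ = M.s
  · have hx₀ : x₀ ≠ M.s := fun hx₀ => hne (Prod.ext hx₀ hy₀)
    obtain ⟨u, U, hU, hxU, hu, h⟩ := exists_contMDiffOn_smulX_base hx₀
    refine ⟨Prod.fst ⁻¹' U, fun a => M.smulX (u a.1) a.2, hU.preimage continuous_fst, hxU, ?_, ?_⟩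
    · intro a ha
      have h1 := ((hu.contMDiffAt (hU.mem_nhds ha)).comp a contMDiffAt_fst).prodMk
        (contMDiffAt_snd (I := 𝓘(ℝ, E)) (J := 𝓘(ℝ, E)) (n := ∞) (p := a))
      exact ((contMDiffAt_smulX (h _ ha).1 a.2).comp a h1).contMDiffWithinAt
    · rintro ⟨x, y⟩ ⟨hx, hH, -⟩
      exact add_eq_left (h x hx).1 hH (h x hx).2
  · obtain ⟨u, U, hU, hyU, hu, h⟩ := exists_contMDiffOn_smulX_base hy₀
    refine ⟨Prod.snd ⁻¹' U, fun a => M.smulX (u a.2) a.1, hU.preimage continuous_snd, hyU, ?_, ?_⟩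
    · intro a ha
      have h1 := ((hu.contMDiffAt (hU.mem_nhds ha)).comp a contMDiffAt_snd).prodMk
        (contMDiffAt_fst (I := 𝓘(ℝ, E)) (J := 𝓘(ℝ, E)) (n := ∞) (p := a))
      exact ((contMDiffAt_smulX (h _ ha).1 a.1).comp a h1).contMDiffWithinAt
    · rintro ⟨x, y⟩ ⟨hy, hH, -⟩
      exact add_eq_right (h y hy).1 (ne_s_of_smulX_base (h y hy).1 (h y hy).2) hH (h y hy).2

lemma H_add {x y : M.X} (hH : M.H x = M.H y) : M.H (M.add (x, y)) = M.H x := by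
  rw [add]
  split_ifs
  · exact (H_smulX (pos_ne_zero x) y).trans hH.symm
  · exact H_smulX (pos_ne_zero y) x

lemma H_s : M.H M.s = 0 := by rw [← toX_zero, H_toX zero_mem_tube]; simp [stdH]

lemma exists_exp_eq {w : ℂ} (hw : w ≠ 0) :
    ∃ t : ℝ × ℝ, w = Complex.exp (t.1 + t.2 * Complex.I) :=
  ⟨((Complex.log w).re, (Complex.log w).im), by rw [Complex.re_add_im, Complex.exp_log hw]⟩

/-- Off the singular fiber neither point is `s`, and logarithms of their positions serve as flow
times. The forward direction contains the independence of the sum from the times `t`, `t'`. -/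
lemma isSum_iff {x y z : M.X} (hH : M.H x = M.H y) (h0 : M.H x ≠ 0) :
    M.IsSum x y z ↔ z = M.add (x, y) := by
  have hx : x ≠ M.s := fun h => h0 (by rw [h, H_s])
  have hy : y ≠ M.s := fun h => h0 (by rw [hH, h, H_s])
  have hexp : ∀ t t' : ℝ × ℝ, Complex.exp ((t + t').1 + (t + t').2 * Complex.I) =
      Complex.exp (t'.1 + t'.2 * Complex.I) * Complex.exp (t.1 + t.2 * Complex.I) := by
    intro t t'
    rw [← Complex.exp_add]
    congr 1
    push_cast [Prod.fst_add, Prod.snd_add]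
    ring
  simp only [IsSum, jointFlowsTo_iff]
  change (∃ t t' : ℝ × ℝ, x = M.smulX _ (M.base x) ∧ y = M.smulX _ (M.base x) ∧
    z = M.smulX _ (M.base x)) ↔ _
  constructor
  · rintro ⟨t, t', h1, h2, h3⟩
    rw [base_eq_of_H_eq hH] at h2
    rw [add_eq_right (Complex.exp_ne_zero _) hy hH h2.symm, h3, hexp,
      smulX_mul (Complex.exp_ne_zero _) (Complex.exp_ne_zero _), ← h1]
  · rintro rfl
    obtain ⟨t, ht⟩ := exists_exp_eq (pos_ne_zero x)
    obtain ⟨t', ht'⟩ := exists_exp_eq (pos_ne_zero y)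
    refine ⟨t, t', ?_, ?_, ?_⟩
    · rw [← ht, smulX_pos hx]
    · rw [← ht', base_eq_of_H_eq hH, smulX_pos hy]
    · rw [hexp, ← ht, ← ht', smulX_mul (pos_ne_zero y) (pos_ne_zero x), smulX_pos hx,
        add_eq_right (pos_ne_zero y) hy hH (smulX_pos hy)]

/-! ### The singular fiber -/

lemma base_eq_of_H_eq_zero {x : M.X} (hx : M.H x = 0) : M.base x = M.base M.s :=
  base_eq_of_H_eq (hx.trans H_s.symm)

lemma base_s_eq : M.base M.s = M.toX (0, 1) := by
  rw [base, secS_eq_toX_σ₂]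
  simp [σ₂, H_s]

lemma mem_tube_of_fst_eq {q : ℂ} : ((0, q) : E) ∈ M.tube := by simpa [tube] using M.ε_pos

lemma base_s_eq' : M.base M.s = M.toX (M.eS 0, 0) := by
  rw [base_s_eq, ← toX_glueMap mem_tube_of_fst_eq one_ne_zero]
  simp [glueMap, stdH]

/-- Both branches describe `z · σ_S(0)`, computed from `σ₁(0) = (e^{S₁(0) + i S₂(0)}, 0)` and from
`σ₂(0) = (0, 1)` respectively. -/
lemma param_eq (z : ℂˣ) : M.param z = M.smulX z (M.base M.s) := by
  rw [param]
  split_ifs with h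
  · rw [base_s_eq', smulX_toX z.ne_zero (by simpa [tube] using M.ε_pos), ← toX_eq_proj]
    simp [act]
  · rw [base_s_eq, smulX_toX z.ne_zero mem_tube_of_fst_eq, ← toX_eq_proj]
    simp [act]

open Relation in
lemma eq_of_reflTransGen_fst_eq {q q' : ℂ} (h : ReflTransGen M.Step (0, q) (0, q')) : q = q' := by
  rcases h.cases_tail with h | ⟨z, -, h⟩
  · exact (congrArg Prod.snd h).symm
  · exact (h.fst_ne rfl).elim

/-- All points are represented as `(0, 1 / z̄)`, also for `|z| < 1`, where this lies outside `X'`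
but in the tube. No step ends at `p = 0`, so distinct points of this line have distinct classes. -/
lemma param_injective : Function.Injective M.param := by
  intro z w h
  rw [param_eq, param_eq, base_s_eq, smulX_toX z.ne_zero mem_tube_of_fst_eq,
    smulX_toX w.ne_zero mem_tube_of_fst_eq, act, act, mul_zero, mul_zero,
    toX_eq_iff mem_tube_of_fst_eq mem_tube_of_fst_eq] at h
  have h1 : 1 / conj (z : ℂ) = 1 / conj (w : ℂ) := by
    rcases Step.reflTransGen_or h with h | h
    · exact eq_of_reflTransGen_fst_eq h
    · exact (eq_of_reflTransGen_fst_eq h).symm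
  rw [one_div, one_div, inv_inj, (starRingEnd ℂ).injective.eq_iff] at h1
  exact Units.ext h1

lemma param_mem (z : ℂˣ) : M.param z ∈ M.regFiber := by
  rw [param_eq]
  refine ⟨?_, smulX_ne_s z.ne_zero (base_ne_s _)⟩
  rw [mem_ofPred_eq, H_smulX z.ne_zero, base_s_eq, H_toX mem_tube_of_fst_eq]
  simp [stdH]

lemma exists_param_eq {x : M.X} (hx : x ∈ M.regFiber) : ∃ z, M.param z = x :=
  ⟨Units.mk0 (M.pos x) (pos_ne_zero x), by
    rw [param_eq, Units.val_mk0, ← base_eq_of_H_eq_zero hx.1, smulX_pos hx.2]⟩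

lemma add_param (z w : ℂˣ) : M.add (M.param z, M.param w) = M.param (z * w) := by
  have hz := param_mem (M := M) z
  have hw := param_mem (M := M) w
  have hH : M.H (M.param z) = M.H (M.param w) := hz.1.trans hw.1.symm
  rw [add_eq_left z.ne_zero hH (by rw [base_eq_of_H_eq_zero hz.1, param_eq]),
    param_eq w, param_eq (z * w), ← smulX_mul z.ne_zero w.ne_zero, Units.val_mul]

variable (M) in
/-- The parametrization of the regular part of the singular fiber as a bijection. -/
def paramEquiv : ℂˣ ≃ M.regFiber :=
  Equiv.ofBijective (fun z => ⟨M.param z, param_mem z⟩)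
    ⟨fun _ _ h => param_injective (congrArg Subtype.val h),
      fun x => (exists_param_eq x.2).imp fun _ h => Subtype.ext h⟩

lemma add_s {x : M.X} (hx : x ∈ M.regFiber) : M.add (M.s, x) = M.s ∧ M.add (x, M.s) = M.s := by
  have h1 : M.H M.s = M.H x := H_s.trans hx.1.symm
  constructor
  · rw [add_eq_right (pos_ne_zero x) hx.2 h1 (smulX_pos hx.2), smulX_s (pos_ne_zero x)]
  · rw [add_eq_left (pos_ne_zero x) h1.symm (smulX_pos hx.2), smulX_s (pos_ne_zero x)]

end Model

end FocusFocus

end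

theorem propositionp3p5 (M : FocusFocus.Model) :
    ∃ F : M.X × M.X → M.X,
      M.SmoothAlong F M.fiberProd ∧
      (∀ a ∈ M.fiberProd, M.H (F a) = M.H a.1) ∧
      (∀ x y z : M.X, M.H x = M.H y → M.H x ≠ 0 → (M.IsSum x y z ↔ z = F (x, y))) ∧
      (∃ e : ℂˣ ≃ M.regFiber,
        (∀ z : ℂˣ, (e z : M.X) = M.param z) ∧
        ∀ z w : ℂˣ, F ((e z : M.X), (e w : M.X)) = e (z * w)) ∧
      (∀ x ∈ M.regFiber, F (M.s, x) = M.s ∧ F (x, M.s) = M.s) := by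
  open FocusFocus.Model in
  exact ⟨M.add, smoothAlong_add, fun _ ha => H_add ha.1, fun _ _ _ => isSum_iff,
    ⟨M.paramEquiv, fun _ => rfl, add_param⟩, fun _ => add_s⟩
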